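/- **Setting.** An instance of a Metrical Task System (MTS) consists of a metric space $M$ of finite diameter $D$, an initial state $s_0\in M$ and cost functions $c_1,\dots,c_T\colon M\to[0,\infty]$. A solution $s_1,\dots,s_T\in M$ costs $\sum_{t=1}^T\big(c_t(s_t)+d(s_{t-1},s_t)\big)$; the least possible cost is the offline optimum. There are $\ell\ge 1$ heuristics $H_1,\dots,H_\ell$; $s^i_t$ is the state of $H_i$ at time $t$, with $s^i_0=s_0$, and the costs $f_t(i)=c_t(s_t^i)+d(s_{t-1}^i,s_t^i)$ lie in $[0,2D]$. For $k\ge1$, $\mathrm{OPT}_{\le k}$ is the minimum of $\sum_{t=1}^T\big(c_t(s_t^{i_t})+d(s_{t-1}^{i_{t-1}},s_t^{i_t})\big)$ over all $i_1,\dots,i_T$ in $\{1,\dots,\ell\}$ with at most $k$ steps $t\ge 2$ such that $i_{t-1}\ne i_t$. Let $m\ge2$. With $m$-delayed bandit access, an algorithm queries one heuristic in each step $1,\dots,T$; the query of $H_i$ at time $t$ returns $s_t^i$ if $H_i$ was queried in all steps $t-m+2,\dots,t$, and returns nothing otherwise. **Algorithm** (parameters $\epsilon,\eta,\alpha$). Draw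 independent $\beta_1,\dots,\beta_T\sim\mathrm{Bernoulli}(\epsilon)$ and independent uniform $e_t\in\{1,\dots,\ell\}$; put $\beta_0=0$. Step $0$ is an exploitation step. If $t$ is an exploitation step with $\beta_t=0$, then $t+1$ is an exploitation step. If $t$ is an exploitation step with $\beta_t=1$, then $H_{e_{t+m}}$ is queried in steps $t+1,\dots,t+m$, step $t+m$ is an exploration step, and $t+m+1$ is again an exploitation step. The learner SHARE keeps weights $w_t\in(0,\infty)^\ell$ with $w_0=(1,\dots,1)$ and the distribution $x_t=w_t/\sum_j w_t(j)$. After an exploration step $t$ it receives the loss vector $g_t$ with $g_t(e_t)=f_t(e_t)/(2D)$ and $g_t(i)=0$ for $i\neq e_t$, and sets $w_{t+1}(i)=w_t(i)e^{-\eta g_t(i)}+\frac{\alpha}{\ell}\sum_j w_t(j)(1-e^{-\eta g_t(j)})$; after all other steps $w_{t+1}=w_t$. The exploited heuristic $i_t$ is sampled as follows: $i_0$ is uniform; $i_t=i_{t-1}$ if $x_t=x_{t-1}$; otherwise, given $i_{t-1}=i$, $i_t=j$ with probability $\tau_{ij}/x_{t-1}(i)$, where $\tau$ is a transport plan from $x_{t-1}$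 to $x_t$ that moves the least possible mass $\sum_i\max(0,x_{t-1}(i)-x_t(i))$. In exploitation steps $t\geq 1$ the algorithm queries $H_{i_t}$. If the answer to the query at time $t$ is the state $s_t^{i_t}$, the algorithm goes there and puts $b_t=s_t^{i_t}$; otherwise $b_t=b_{t-1}$ (with $b_0=s_0$) and it goes to a state minimizing $d(b_t,s)+c_t(s)$ over $s\in M$ (such minimizers are assumed to exist). Its expected cost is $\mathbb E[\mathrm{ALG}]$. **Theorem.** There is a universal constant $C>0$ such that the following holds for all $D$, $\ell\ge1$, $m\ge 2$, $k\geq 1$ and all instances as above whose offline optimum is at least $2k$. Put $$\epsilon=\frac{(D\ell k)^{1/3}}{m^{4/3}\,\mathrm{OPT}_{\le k}^{1/3}},\qquad \alpha=\frac{D\ell k}{\epsilon\,\mathrm{OPT}_{\le k}}=\Big(\frac{D\ell k m^2}{\mathrm{OPT}_{\le k}}\Big)^{2/3},\qquad \gamma=\sqrt{\frac{D\ell k}{\epsilon\,\mathrm{OPT}_{\le k}}},\qquad \eta=\ln\frac1{1-\gamma},$$ and suppose that these parameters are admissible for SHARE, i.e. $\alpha\le\frac12$. Then the algorithm with these parameters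 satisfies $$\mathbb E[\mathrm{ALG}]\le \mathrm{OPT}_{\le k}+C\,(D\ell k)^{1/3}m^{2/3}\,\mathrm{OPT}_{\le k}^{2/3}\,\ln\frac{\ell^{1/3}\,\mathrm{OPT}_{\le k}^{2/3}}{(Dk)^{2/3}m^{4/3}} .$$ (If $D\ge1$ and $k$ is fixed, the condition $\alpha\le\frac12$ holds whenever $D\ell m=o(\mathrm{OPT}_{\le k}^{1/3})$ and $\mathrm{OPT}_{\le k}$ is large enough.) -/

import Mathlib

open scoped ENNReal BigOperators

namespace MTS

/-- An instance of a Metrical Task System on the metric space `M`, of length `T`, with cost functions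
`c 1, …, c T` (the value `∞` is allowed) and initial state `s₀`, together with the solutions of `ℓ`
heuristics: `state i t` is the state of the `i`-th heuristic at time `t`. All heuristics start in `s₀`. -/
structure Instance (M : Type*) [MetricSpace M] (ℓ : ℕ) where
  T : ℕ
  c : ℕ → M → ℝ≥0∞
  s₀ : M
  state : Fin ℓ → ℕ → M
  state_zero : ∀ i, state i 0 = s₀

/-! ### Costs and benchmarks -/

section Benchmarks

variable {M : Type*} [MetricSpace M] {ℓ : ℕ}

/-- The diameter `D` of the metric space. -/
noncomputable def diameter (M : Type*) [MetricSpace M] : ℝ := Metric.diam (Set.univ : Set M)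

/-- Total cost (service plus movement) of the solution `s 1, …, s T` starting in `s 0`. -/
noncomputable def Instance.pathCost (P : Instance M ℓ) (s : ℕ → M) : ℝ≥0∞ :=
  ∑ t ∈ Finset.Icc 1 P.T, (P.c t (s t) + edist (s (t - 1)) (s t))

/-- The cost of an optimal offline solution (which need not follow the heuristics). -/
noncomputable def Instance.offlineOpt (P : Instance M ℓ) : ℝ≥0∞ :=
  ⨅ (s : ℕ → M) (_ : s 0 = P.s₀), P.pathCost s

/-- `f_t(i)`, the cost incurred by the `i`-th heuristic at time `t ≥ 1`. -/
noncomputable def Instance.f (P : Instance M ℓ) (i : Fin ℓ) (t : ℕ) : ℝ≥0∞ :=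
  P.c t (P.state i t) + edist (P.state i (t - 1)) (P.state i t)

/-- `OPT_{≤ k}`: the cost of the best combination `i 1, …, i T` of the heuristics which switches
between heuristics at most `k` times (`i 0` is irrelevant: all heuristics are in `s₀` at time `0`). -/
noncomputable def Instance.optLE (P : Instance M ℓ) (k : ℕ) : ℝ≥0∞ :=
  ⨅ (i : ℕ → Fin ℓ) (_ : ((Finset.Icc 2 P.T).filter fun t => i (t - 1) ≠ i t).card ≤ k),
    P.pathCost fun t => P.state (i t) t

end Benchmarks

/-! ### The learner SHARE -/

/-- One update of the weights of SHARE with learning rate `η` and sharing parameter `α`,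
after receiving the loss vector `g`. -/
noncomputable def shareUpdate {ℓ : ℕ} (η α : ℝ) (w g : Fin ℓ → ℝ) : Fin ℓ → ℝ := fun i =>
  w i * Real.exp (-η * g i) + α * (∑ j, (w j - Real.exp (-η * g j) * w j)) / ℓ

/-! ### Rounding -/

/-- `τ p p' i j` is the mass transferred from `p i` to `p' j` by an optimal transport plan
(for the uniform metric on the indices) between the probability vectors `p` and `p'`. -/
structure IsOptimalPlan {ℓ : ℕ} (τ : (Fin ℓ → ℝ) → (Fin ℓ → ℝ) → Fin ℓ → Fin ℓ → ℝ) : Prop where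
  nonneg : ∀ p ∈ stdSimplex ℝ (Fin ℓ), ∀ p' ∈ stdSimplex ℝ (Fin ℓ), ∀ i j, 0 ≤ τ p p' i j
  source : ∀ p ∈ stdSimplex ℝ (Fin ℓ), ∀ p' ∈ stdSimplex ℝ (Fin ℓ), ∀ i, ∑ j, τ p p' i j = p i
  target : ∀ p ∈ stdSimplex ℝ (Fin ℓ), ∀ p' ∈ stdSimplex ℝ (Fin ℓ), ∀ j, ∑ i, τ p p' i j = p' j
  optimal : ∀ p ∈ stdSimplex ℝ (Fin ℓ), ∀ p' ∈ stdSimplex ℝ (Fin ℓ),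
    ∑ i, ∑ j, (if i = j then 0 else τ p p' i j) = ∑ i, max 0 (p i - p' i)

/-- The probability that `Round` moves from `i` to `j` when the distribution changes from `p` to `p'`;
if the distribution does not change, the index is kept. -/
noncomputable def roundProb {ℓ : ℕ} (τ : (Fin ℓ → ℝ) → (Fin ℓ → ℝ) → Fin ℓ → Fin ℓ → ℝ)
    (p p' : Fin ℓ → ℝ) (i j : Fin ℓ) : ℝ :=
  open Classical in
  if p' = p then (if j = i then 1 else 0) else τ p p' i j / p i

/-! ### The algorithm, for fixed outcomes of its random choices

`β t` is the exploration coin and `e t` the explored heuristic drawn for time `t`;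
`r t` is the index of the exploited heuristic at time `t`. -/

section Dynamics

/-- The control flow of the learning dynamics. `phase m β t = 0` says that `t` is an exploitation step
(`t ∈ X`); `phase m β t = j` with `1 ≤ j ≤ m` says that `t - j` is an exploitation step with
`β (t - j) = 1`. So `phase m β t = m` says that `t` is an exploration step (`t ∈ E`), and the
next step is an exploitation step again. -/
def phase (m : ℕ) (β : ℕ → Bool) : ℕ → ℕ
  | 0 => 0
  | t + 1 =>
    if phase m β t = 0 then (if β t then 1 else 0)
    else if phase m β t = m then 0
    else phase m β t + 1

/-- The heuristic queried at time `t`: the exploited one in an exploitation step; otherwise the one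
which is to be explored at the end `t + (m - phase m β t)` of the current exploration block. -/
def query {ℓ : ℕ} (m : ℕ) (β : ℕ → Bool) (e r : ℕ → Fin ℓ) (t : ℕ) : Fin ℓ :=
  if phase m β t = 0 then r t else e (t + (m - phase m β t))

variable {M : Type*} [MetricSpace M] {ℓ : ℕ}

/-- `m`-delayed bandit access: if `q 1, q 2, …` are the queried heuristics, then the query at time `t`
yields the state of `q t` if this heuristic was queried in all of the steps `t - m + 2, …, t`
(queries are made from time `1` on); otherwise the result is empty. -/
def Instance.reply (P : Instance M ℓ) (m : ℕ) (q : ℕ → Fin ℓ) (t : ℕ) : Option M :=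
  if m - 1 ≤ t ∧ ∀ j < m - 1, q (t - j) = q t then some (P.state (q t) t) else none

/-- The loss vector `g_t^{e_t}` fed to the learner in an exploration step `t`. -/
noncomputable def Instance.loss (P : Instance M ℓ) (e : ℕ → Fin ℓ) (t : ℕ) : Fin ℓ → ℝ := fun i =>
  if i = e t then (P.f i t).toReal / (2 * diameter M) else 0

/-- The weights of SHARE, updated after each exploration step. -/
noncomputable def Instance.weights (P : Instance M ℓ) (m : ℕ) (η α : ℝ) (β : ℕ → Bool)
    (e : ℕ → Fin ℓ) : ℕ → Fin ℓ → ℝ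
  | 0 => fun _ => 1
  | t + 1 =>
    if phase m β t = m then shareUpdate η α (P.weights m η α β e t) (P.loss e t)
    else P.weights m η α β e t

/-- The distribution `x_t` over the heuristics. -/
noncomputable def Instance.x (P : Instance M ℓ) (m : ℕ) (η α : ℝ) (β : ℕ → Bool)
    (e : ℕ → Fin ℓ) (t : ℕ) : Fin ℓ → ℝ := fun i =>
  P.weights m η α β e t i / ∑ j, P.weights m η α β e t j

/-- The state of the exploited heuristic at time `t`, if the replies to the queries reveal it. -/
def Instance.known (P : Instance M ℓ) (m : ℕ) (β : ℕ → Bool) (e r : ℕ → Fin ℓ) (t : ℕ) : Option M :=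
  if query m β e r t = r t then P.reply m (query m β e r) t else none

/-- `b_t`, the last known state of an exploited heuristic. -/
def Instance.base (P : Instance M ℓ) (m : ℕ) (β : ℕ → Bool) (e r : ℕ → Fin ℓ) : ℕ → M
  | 0 => P.s₀
  | t + 1 => (P.known m β e r (t + 1)).getD (P.base m β e r t)

/-- `greedy t b` minimizes `d(b, s) + c_t(s)` over all states `s` (ties are broken arbitrarily). -/
def Instance.IsGreedy (P : Instance M ℓ) (greedy : ℕ → M → M) : Prop :=
  ∀ t ∈ Finset.Icc 1 P.T, ∀ b s : M,
    edist b (greedy t b) + P.c t (greedy t b) ≤ edist b s + P.c t s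

/-- `s_t`, the state of the algorithm: that of the exploited heuristic if it is known,
otherwise a greedy step from the last known state. -/
def Instance.algState (P : Instance M ℓ) (m : ℕ) (greedy : ℕ → M → M) (β : ℕ → Bool)
    (e r : ℕ → Fin ℓ) : ℕ → M
  | 0 => P.s₀
  | t + 1 => (P.known m β e r (t + 1)).getD (greedy (t + 1) (P.base m β e r t))

lemma phase_le (m : ℕ) (β : ℕ → Bool) (t : ℕ) : phase m β t ≤ t := by
  induction t with
  | zero => simp [phase]
  | succ t ih => simp only [phase]; split_ifs <;> omega

lemma phase_sub {m : ℕ} {β : ℕ → Bool} {t : ℕ} (h : phase m β t = m) :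
    ∀ j < m, phase m β (t - j) = m - j := by
  intro j
  induction j with
  | zero => intro _; simpa using h
  | succ j ih =>
    intro hj
    have h1 := ih (by omega)
    obtain ⟨u, hu⟩ : ∃ u, t - j = u + 1 := by
      have := phase_le m β (t - j)
      exact ⟨t - j - 1, by omega⟩
    have h2 : t - (j + 1) = u := by omega
    rw [hu, phase] at h1
    rw [h2]
    split_ifs at h1 <;> omega

/-- The loss used in an exploration step `t` is available under `m`-delayed bandit access: the queries
at times `t - 1` and `t` do reveal the states of the explored heuristic `e t`. -/
theorem Instance.reply_exploration (P : Instance M ℓ) {m : ℕ} (hm : 2 ≤ m) {β : ℕ → Bool}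
    (e r : ℕ → Fin ℓ) {t : ℕ} (h : phase m β t = m) :
    P.reply m (query m β e r) (t - 1) = some (P.state (e t) (t - 1)) ∧
      P.reply m (query m β e r) t = some (P.state (e t) t) := by
  have hmt : m ≤ t := h ▸ phase_le m β t
  have hq : ∀ j < m, query m β e r (t - j) = e t := by
    intro j hj
    have h1 := phase_sub h j hj
    have h2 : t - j + (m - (m - j)) = t := by omega
    rw [query, h1, if_neg (by omega), h2]
  have h0 : query m β e r t = e t := hq 0 (by omega)
  have h1 : query m β e r (t - 1) = e t := hq 1 (by omega)
  have c1 : m - 1 ≤ t - 1 ∧ ∀ j < m - 1, query m β e r (t - 1 - j) = e t :=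
    ⟨by omega, fun j hj => by rw [Nat.sub_sub]; exact hq (1 + j) (by omega)⟩
  have c0 : m - 1 ≤ t ∧ ∀ j < m - 1, query m β e r (t - j) = e t :=
    ⟨by omega, fun j hj => hq j (by omega)⟩
  constructor
  · simp only [Instance.reply, h1]
    exact if_pos c1
  · simp only [Instance.reply, h0]
    exact if_pos c0

end Dynamics

/-! ### The random choices and the expected cost -/

section Expectation

variable {M : Type*} [MetricSpace M] {ℓ : ℕ}

/-- Outcomes of the random choices: the coins `β_1, …, β_T`, the explored heuristics `e_1, …, e_{T+m}`
(those after time `T` only determine the queries in an exploration block cut off by the end of the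
instance), and the exploited heuristics `i_0, …, i_T`. -/
abbrev Outcome (T m ℓ : ℕ) : Type := (Fin T → Bool) × (Fin (T + m) → Fin ℓ) × (Fin (T + 1) → Fin ℓ)

/-- `β_t` for `1 ≤ t ≤ T`, and `β_0 = 0`. -/
def Outcome.β {T m ℓ : ℕ} (ω : Outcome T m ℓ) (t : ℕ) : Bool :=
  if h : 1 ≤ t ∧ t ≤ T then ω.1 ⟨t - 1, by omega⟩ else false

/-- `e_t` for `1 ≤ t ≤ T + m`. -/
def Outcome.e {T m ℓ : ℕ} [NeZero ℓ] (ω : Outcome T m ℓ) (t : ℕ) : Fin ℓ :=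
  if h : 1 ≤ t ∧ t ≤ T + m then ω.2.1 ⟨t - 1, by omega⟩ else 0

/-- `i_t` for `0 ≤ t ≤ T`. -/
def Outcome.i {T m ℓ : ℕ} [NeZero ℓ] (ω : Outcome T m ℓ) (t : ℕ) : Fin ℓ :=
  if h : t ≤ T then ω.2.2 ⟨t, by omega⟩ else 0

/-- The probability of an outcome: the `β_t` are independent Bernoulli variables with parameter `ε`, the
`e_t` are independent and uniform, `i_0` is uniform, and `i_t` is produced from `i_{t-1}`
by `Round` applied to `x_{t-1}` and `x_t`, with fresh randomness. -/
noncomputable def Instance.prob [NeZero ℓ] (P : Instance M ℓ) (m : ℕ) (ε η α : ℝ)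
    (τ : (Fin ℓ → ℝ) → (Fin ℓ → ℝ) → Fin ℓ → Fin ℓ → ℝ) (ω : Outcome P.T m ℓ) : ℝ :=
  (∏ t ∈ Finset.Icc 1 P.T, if ω.β t then ε else 1 - ε) *
  (∏ _t ∈ Finset.Icc 1 (P.T + m), 1 / (ℓ : ℝ)) *
  ((1 / (ℓ : ℝ)) * ∏ t ∈ Finset.Icc 1 P.T,
    roundProb τ (P.x m η α ω.β ω.e (t - 1)) (P.x m η α ω.β ω.e t) (ω.i (t - 1)) (ω.i t))

/-- `E[ALG]`: the expected cost of the algorithm with exploration rate `ε`, using SHARE with learning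
rate `η` and sharing parameter `α` as its internal learner. -/
noncomputable def Instance.expectedCost [NeZero ℓ] (P : Instance M ℓ) (m : ℕ) (ε η α : ℝ)
    (τ : (Fin ℓ → ℝ) → (Fin ℓ → ℝ) → Fin ℓ → Fin ℓ → ℝ) (greedy : ℕ → M → M) : ℝ≥0∞ :=
  ∑ ω : Outcome P.T m ℓ, ENNReal.ofReal (P.prob m ε η α τ ω) *
    P.pathCost (P.algState m greedy ω.β ω.e ω.i)

end Expectation

/-! ### The choice of the parameters, given `D`, `ℓ`, `k`, `m` and the value `V` of `OPT_{≤ k}` -/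

/-- The exploration rate `ε`. -/
noncomputable def paramε (D ℓ k m V : ℝ) : ℝ :=
  V ^ (-(1 / 3) : ℝ) * (D * ℓ * k) ^ (1 / 3 : ℝ) * m ^ (-(4 / 3) : ℝ)

/-- The sharing parameter `α`. -/
noncomputable def paramα (D ℓ k m V : ℝ) : ℝ := D * ℓ * k / (paramε D ℓ k m V * V)

/-- The learning rate `η = ln (1 / (1 - γ))`, that is, `γ = 1 - exp (-η)`,
where `γ = √(D ℓ k / (ε V))`. -/
noncomputable def paramη (D ℓ k m V : ℝ) : ℝ :=
  Real.log (1 / (1 - Real.sqrt (D * ℓ * k / (paramε D ℓ k m V * V))))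

end MTS

/-! Write V for the benchmark and γ² = α. The choice of the parameters amounts to m²ε = γ and Dℓk =
αεV (`params_spec`), and the permitted excess is a constant times γ V ln(ℓ/α). So all errors must
have relative size O(γ), or γ times the logarithm.

Pathwise, call a step settled if the last m - 1 steps were all exploitation steps; then the delayed
replies reveal the exploited heuristic. Otherwise the algorithm may have to move greedily from an
outdated position. An amortization (`Instance.pathCost_algState_le`) charges each step's cost of the
exploited heuristics with weight 1 + 2U, where U is the length of the unsettled run starting there.
Such a run has expected length O(m) whatever happened before (`coinExp_unsettledRun_le`). Apart from
the first m steps, a step is unsettled only because of a nearby exploration block, an event of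
probability O(mε); so the excess has relative size O(m²ε) = O(γ), up to multiples of the learner's
loss (`coinExp_step_le`). A switch costs at most D, and one update moves mass at most η times the
learner's loss (`movement_le`).

What remains is the cost of the distribution x_t itself. The weights are frozen during a block, and
the coin and the explored index are independent of them. Hence the learner's expected loss is
exactly ε/(2Dℓ) times the observable cost, that is, the cost on the event that t - m is an
exploitation step (`expLoss_eq`). Outside this event a block started at most 2m steps before t; this
has probability O(mε), and its update inflates average costs only by a constant factor and a loss
term (`expMean_le_observable`). Finally `share_regret`, applied to the sparse losses and rescaled by
2Dℓ/ε, bounds the observable cost by V plus admissible errors (`observable_le_benchmark`). -/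

namespace MTS

/-! ### Structure of the exploration blocks -/

section Phase

variable {m : ℕ} {β β' : ℕ → Bool} {s t : ℕ}

lemma phase_le_delay (hm : 1 ≤ m) (β : ℕ → Bool) (t : ℕ) : phase m β t ≤ m := by
  induction t with
  | zero => simp [phase]
  | succ t ih => simp only [phase]; split_ifs <;> omega

lemma phase_congr (h : ∀ s < t, β s = β' s) : phase m β t = phase m β' t := by
  induction t with
  | zero => rfl
  | succ t ih =>
    simp only [phase]
    rw [ih fun s hs => h s (by omega), h t (by omega)]

/-- The block of a step which is not an exploitation step was started by a successful coin. -/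
lemma start_of_phase_ne_zero (h : phase m β t ≠ 0) :
    phase m β (t - phase m β t) = 0 ∧ β (t - phase m β t) = true := by
  induction t with
  | zero => simp [phase] at h
  | succ t ih =>
    simp only [phase] at h ⊢
    by_cases h0 : phase m β t = 0
    · cases hb : β t <;> simp_all
    · by_cases h1 : phase m β t = m
      · simp_all
      · simpa [h0, h1] using ih h0

lemma phase_add_of_start (hs : phase m β s = 0) (hb : β s = true) {j : ℕ} (h1 : 1 ≤ j)
    (hj : j ≤ m) : phase m β (s + j) = j := by
  induction j, h1 using Nat.le_induction with
  | base => simp [phase, hs, hb]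
  | succ j h1 ih =>
    have := ih (by omega)
    rw [← add_assoc, phase, this, if_neg (by omega), if_neg (by omega)]

lemma phase_block_end (hm : 1 ≤ m) (h : phase m β t = m) : phase m β (t + 1) = 0 := by
  rw [phase, h, if_neg (by omega), if_pos rfl]

/-- An exploration step is preceded by m - 1 further steps of its block, so none occurs fewer than m
steps after an exploitation step. This freezes the weights in `Instance.weights_add`. -/
lemma phase_add_ne_delay (hs : phase m β s = 0) {j : ℕ} (hj : j < m) :
    phase m β (s + j) ≠ m := by
  intro h
  have := phase_sub h j hj
  rw [Nat.add_sub_cancel, hs] at this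
  omega

lemma phase_eq_zero_of_no_start (hs : phase m β s = 0) {j : ℕ}
    (h : ∀ i < j, β (s + i) = false) : phase m β (s + j) = 0 := by
  induction j with
  | zero => exact hs
  | succ j ih =>
    rw [← add_assoc, phase, ih fun i hi => h i (by omega), h j (by omega)]
    simp

/-- Exploration at time s + m is thus decided by the coins up to time s. -/
lemma phase_add_delay_iff (hm : 1 ≤ m) :
    phase m β (s + m) = m ↔ phase m β s = 0 ∧ β s = true := by
  constructor
  · intro h
    have := start_of_phase_ne_zero (m := m) (β := β) (t := s + m) (by omega)
    rwa [h, Nat.add_sub_cancel] at this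
  · rintro ⟨h, hb⟩
    exact phase_add_of_start h hb hm le_rfl

end Phase

/-! ### A pathwise bound on the cost -/

open Classical in
/-- Equals `1` unless the last `m - 1` steps up to `t` were exploitation steps. -/
noncomputable def unsettled (m : ℕ) (β : ℕ → Bool) (t : ℕ) : ℕ :=
  if t < m - 1 ∨ ∃ j < m - 1, phase m β (t - j) ≠ 0 then 1 else 0

/-- The length of the run of unsettled steps from `t` on, within the time horizon `T`. -/
noncomputable def unsettledRun (m : ℕ) (β : ℕ → Bool) (T t : ℕ) : ℕ :=
  ∑ n ∈ Finset.range (T + 1 - t), ∏ i ∈ Finset.range (n + 1), unsettled m β (t + i)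

lemma unsettled_le_one (m : ℕ) (β : ℕ → Bool) (t : ℕ) : unsettled m β t ≤ 1 := by
  unfold unsettled; split_ifs <;> omega

/-- This recursion lets the potential in `amortized_step` close up from one step to the next. -/
lemma unsettledRun_eq (m : ℕ) (β : ℕ → Bool) {T t : ℕ} (ht : t ≤ T) :
    unsettledRun m β T t = unsettled m β t * (1 + unsettledRun m β T (t + 1)) := by
  unfold unsettledRun
  obtain ⟨n, rfl⟩ : ∃ n, T = t + n := ⟨T - t, by omega⟩
  rw [show t + n + 1 - t = n + 1 by omega, show t + n + 1 - (t + 1) = n by omega,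
    Finset.sum_range_succ', mul_add, Finset.mul_sum]
  rw [add_comm (unsettled m β t * 1)]
  refine congr_arg₂ _ (Finset.sum_congr rfl fun i _ => ?_) (by simp)
  rw [Finset.prod_range_succ', mul_comm, add_zero]
  simp only [add_assoc, add_comm 1]

section Pathwise

variable {M : Type*} [MetricSpace M] {ℓ : ℕ} (P : Instance M ℓ) {m : ℕ} {β : ℕ → Bool}
  {e r : ℕ → Fin ℓ}

lemma Instance.known_eq_none_or (P : Instance M ℓ) (m : ℕ) (β : ℕ → Bool) (e r : ℕ → Fin ℓ)
    (t : ℕ) : P.known m β e r t = none ∨ P.known m β e r t = some (P.state (r t) t) := by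
  unfold Instance.known Instance.reply
  split_ifs with h1 h2
  · exact .inr (by rw [h1])
  · exact .inl rfl
  · exact .inl rfl

/-- The exploited index changes only after exploration steps. During m - 1 consecutive exploitation
steps it is therefore constant and always queried, which is what a nonempty reply requires. -/
lemma Instance.known_eq_some {T : ℕ}
    (hr : ∀ t, t + 1 ≤ T → phase m β t ≠ m → r (t + 1) = r t) {t : ℕ}
    (ht : t ≤ T) (hm : 2 ≤ m) (h : unsettled m β t = 0) :
    P.known m β e r t = some (P.state (r t) t) := by
  have h' : m - 1 ≤ t ∧ ∀ j < m - 1, phase m β (t - j) = 0 := by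
    unfold unsettled at h
    split_ifs at h with h1
    push Not at h1
    exact h1
  obtain ⟨h1, h2⟩ := h'
  have hconst : ∀ j < m - 1, r (t - j) = r t := by
    intro j
    induction j with
    | zero => simp
    | succ j ih =>
      intro hj
      rw [← ih (by omega), ← hr (t - (j + 1)) (by omega) (by rw [h2 _ hj]; omega)]
      congr 1
      omega
  have hq : ∀ j < m - 1, query m β e r (t - j) = r t := fun j hj => by
    rw [query, if_pos (h2 j hj), hconst j hj]
  have hq0 : query m β e r t = r t := hq 0 (by omega)
  rw [Instance.known, if_pos hq0, Instance.reply, hq0, if_pos ⟨h1, hq⟩]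

/-- If the reply is empty, the step is unsettled, the base stays, and the greedy choice competes
with moving from the base to the exploited state. If the exploited state is known, the algorithm,
the base and this state coincide and both distances vanish. -/
lemma Instance.algState_step {greedy : ℕ → M → M} (hg : P.IsGreedy greedy) (hm : 2 ≤ m)
    (hr : ∀ t, t + 1 ≤ P.T → phase m β t ≠ m → r (t + 1) = r t)
    {t : ℕ} (ht : t + 1 ≤ P.T) {S b p : ℕ → M} (hS : S = P.algState m greedy β e r)
    (hb : b = P.base m β e r) (hp : p = fun t => P.state (r t) t) :
    (P.c (t + 1) (S (t + 1)) + edist (S t) (S (t + 1)) ≤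
        edist (S t) (b t) + (edist (b t) (p (t + 1)) + P.c (t + 1) (p (t + 1)))) ∧
      edist (S (t + 1)) (b (t + 1)) ≤ unsettled m β (t + 1) *
        (edist (b t) (p (t + 1)) + P.c (t + 1) (p (t + 1))) ∧
      edist (b (t + 1)) (p (t + 1)) ≤ unsettled m β (t + 1) * edist (b t) (p (t + 1)) := by
  have hkn : unsettled m β (t + 1) = 0 → P.known m β e r (t + 1) = some (p (t + 1)) := by
    rw [hp]; exact P.known_eq_some hr ht hm
  rcases P.known_eq_none_or m β e r (t + 1) with h | h
  · have hu : unsettled m β (t + 1) = 1 := by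
      have := unsettled_le_one m β (t + 1)
      by_contra hne
      have := hkn (by omega)
      rw [h] at this
      cases this
    have h1 : S (t + 1) = greedy (t + 1) (b t) := by
      simp [hS, hb, Instance.algState, h]
    have h2 : b (t + 1) = b t := by simp [hb, Instance.base, h]
    have h3 := hg (t + 1) (by simp; omega) (b t) (p (t + 1))
    rw [← h1] at h3
    simp only [hu, h2, Nat.cast_one, one_mul]
    refine ⟨?_, ?_, le_rfl⟩
    · calc _ ≤ P.c (t + 1) (S (t + 1)) + (edist (S t) (b t) + edist (b t) (S (t + 1))) := by
            gcongr; exact edist_triangle _ _ _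
        _ = edist (S t) (b t) + (edist (b t) (S (t + 1)) + P.c (t + 1) (S (t + 1))) := by ring
        _ ≤ _ := by gcongr
    · rw [edist_comm]; exact le_self_add.trans h3
  · have h1 : S (t + 1) = p (t + 1) := by simp [hS, Instance.algState, h, hp]
    have h2 : b (t + 1) = p (t + 1) := by simp [hb, Instance.base, h, hp]
    rw [h1, h2, edist_self]
    refine ⟨?_, bot_le, bot_le⟩
    calc _ ≤ P.c (t + 1) (p (t + 1)) + (edist (S t) (b t) + edist (b t) (p (t + 1))) := by
            gcongr; exact edist_triangle _ _ _
      _ = _ := by ring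

/-- The potential is d(S, b) + (1 + 2U) d(b, p), for the algorithm's state S, the base b, the
exploited state p and the run length U from the next step on. A unit of distance Δ from the old base
is paid once in the greedy step, u times for the way back and u(1 + 2U') times later, altogether 1 +
2u(1 + U') = 1 + 2U times. -/
lemma amortized_step {Q a d δ Δ c u U U' C aS aN dN : ℝ≥0∞} (h1 : C ≤ a + (Δ + c))
    (h2 : aN ≤ u * (Δ + c)) (h3 : dN ≤ u * Δ) (hΔ : Δ ≤ d + δ) (hU : U = u * (1 + U'))
    (ih : Q + a + d * (1 + 2 * U) ≤ aS) :
    Q + C + aN + dN * (1 + 2 * U') ≤ aS + (1 + 2 * U) * (c + δ) := by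
  have hu : u ≤ 2 * U := by
    rw [hU, mul_add, mul_one, two_mul, add_assoc]; exact le_self_add
  calc Q + C + aN + dN * (1 + 2 * U')
      ≤ Q + (a + (Δ + c)) + u * (Δ + c) + u * Δ * (1 + 2 * U') := by gcongr
    _ = Q + a + (1 + 2 * (u * (1 + U'))) * Δ + (1 + u) * c := by ring
    _ ≤ Q + a + (1 + 2 * U) * (d + δ) + (1 + 2 * U) * c := by
        rw [← hU]; gcongr
    _ = (Q + a + d * (1 + 2 * U)) + (1 + 2 * U) * (c + δ) := by ring
    _ ≤ _ := by gcongr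

/-- The total cost is dominated by that of the exploited heuristics, each
step counted with the length of the unsettled run which it starts. -/
lemma Instance.pathCost_algState_le {greedy : ℕ → M → M} (hg : P.IsGreedy greedy) (hm : 2 ≤ m)
    (hr : ∀ t, t + 1 ≤ P.T → phase m β t ≠ m → r (t + 1) = r t) :
    P.pathCost (P.algState m greedy β e r) ≤
      ∑ t ∈ Finset.Icc 1 P.T, (1 + 2 * (unsettledRun m β P.T t : ℝ≥0∞)) *
        (P.c t (P.state (r t) t) +
          edist (P.state (r (t - 1)) (t - 1)) (P.state (r t) t)) := by
  obtain ⟨S, hS⟩ : ∃ S, S = P.algState m greedy β e r := ⟨_, rfl⟩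
  obtain ⟨b, hb⟩ : ∃ b, b = P.base m β e r := ⟨_, rfl⟩
  obtain ⟨p, hp⟩ : ∃ p : ℕ → M, p = fun t => P.state (r t) t := ⟨_, rfl⟩
  have key : ∀ n, n ≤ P.T →
      ∑ t ∈ Finset.Icc 1 n, (P.c t (S t) + edist (S (t - 1)) (S t)) + edist (S n) (b n) +
        edist (b n) (p n) * (1 + 2 * (unsettledRun m β P.T (n + 1) : ℝ≥0∞)) ≤
      ∑ t ∈ Finset.Icc 1 n, (1 + 2 * (unsettledRun m β P.T t : ℝ≥0∞)) *
        (P.c t (p t) + edist (p (t - 1)) (p t)) := by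
    intro n
    induction n with
    | zero => simp [hS, hb, hp, P.state_zero, Instance.algState, Instance.base]
    | succ n ih =>
      intro hn
      obtain ⟨h1, h2, h3⟩ := P.algState_step hg hm hr hn hS hb hp
      rw [Finset.sum_Icc_succ_top (by omega), Finset.sum_Icc_succ_top (by omega),
        Nat.add_sub_cancel]
      exact amortized_step h1 h2 h3 (edist_triangle _ _ _)
        (by rw [unsettledRun_eq m β hn]; push_cast; rfl) (ih (by omega))
  have := key P.T le_rfl
  rw [add_assoc] at this
  subst hp hS
  exact le_self_add.trans this

/-- Moving along the exploited heuristics costs at most their own cost, plus the diameter for each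
switch. -/
lemma Instance.exploited_cost_le [BoundedSpace M] (P : Instance M ℓ) (r : ℕ → Fin ℓ) (t : ℕ) :
    P.c t (P.state (r t) t) + edist (P.state (r (t - 1)) (t - 1)) (P.state (r t) t) ≤
      P.f (r t) t + if r (t - 1) = r t then 0 else ENNReal.ofReal (diameter M) := by
  unfold Instance.f
  rw [add_assoc]
  gcongr
  split_ifs with h
  · rw [h, add_zero]
  · refine le_add_left ?_
    rw [edist_dist]
    exact ENNReal.ofReal_le_ofReal (Metric.dist_le_diam_of_mem (Bornology.IsBounded.all _) trivial trivial)

end Pathwise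

/-! ### The Markov chain of exploited heuristics -/

section Chain

variable {ℓ : ℕ} [NeZero ℓ]

/-- The path `r` on `{0, …, n}` as a function of all times. -/
def extendPath {n : ℕ} (r : Fin (n + 1) → Fin ℓ) (t : ℕ) : Fin ℓ :=
  if h : t ≤ n then r ⟨t, by omega⟩ else 0

/-- The expectation of `g` over paths of length `n` of the Markov chain with initial distribution
`q` and transition matrices `K`. -/
noncomputable def chainExp (q : Fin ℓ → ℝ) (K : ℕ → Fin ℓ → Fin ℓ → ℝ) (n : ℕ)
    (g : (ℕ → Fin ℓ) → ℝ) : ℝ :=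
  ∑ r : Fin (n + 1) → Fin ℓ, q (extendPath r 0) *
    (∏ t ∈ Finset.Icc 1 n, K t (extendPath r (t - 1)) (extendPath r t)) * g (extendPath r)

lemma extendPath_snoc {n : ℕ} (r : Fin (n + 1) → Fin ℓ) (j : Fin ℓ) :
    extendPath (n := n + 1) (Fin.snoc (α := fun _ => Fin ℓ) r j) =
      Function.update (extendPath r) (n + 1) j := by
  funext t
  simp only [extendPath, Function.update_apply, Fin.snoc]
  by_cases h1 : t ≤ n
  · simp [h1, show t ≤ n + 1 by omega, show t < n + 1 by omega, show t ≠ n + 1 by omega]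
  · by_cases h2 : t = n + 1
    · subst h2; simp
    · simp [h1, h2, show ¬ t ≤ n + 1 by omega]

variable {q : Fin ℓ → ℝ} {K : ℕ → Fin ℓ → Fin ℓ → ℝ}

lemma chainExp_succ (n : ℕ) (g : (ℕ → Fin ℓ) → ℝ) :
    chainExp q K (n + 1) g =
      chainExp q K n fun r => ∑ j, K (n + 1) (r n) j * g (Function.update r (n + 1) j) := by
  unfold chainExp
  rw [← (Fin.snocEquiv fun _ : Fin (n + 2) => Fin ℓ).sum_comp, Fintype.sum_prod_type,
    Finset.sum_comm]
  refine Finset.sum_congr rfl fun r _ => ?_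
  rw [Finset.mul_sum]
  refine Finset.sum_congr rfl fun j _ => ?_
  have h : extendPath (n := n + 1) ((Fin.snocEquiv fun _ : Fin (n + 2) => Fin ℓ) (j, r)) =
      Function.update (extendPath r) (n + 1) j := extendPath_snoc r j
  rw [h, Finset.prod_Icc_succ_top (by omega)]
  have h1 : ∏ t ∈ Finset.Icc 1 n, K t (Function.update (extendPath r) (n + 1) j (t - 1))
      (Function.update (extendPath r) (n + 1) j t) =
      ∏ t ∈ Finset.Icc 1 n, K t (extendPath r (t - 1)) (extendPath r t) := by
    refine Finset.prod_congr rfl fun t ht => ?_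
    rw [Finset.mem_Icc] at ht
    rw [Function.update_of_ne (by omega), Function.update_of_ne (by omega)]
  rw [h1, Function.update_of_ne (by omega), Function.update_self, Nat.add_sub_cancel,
    Function.update_of_ne (by omega)]
  ring

variable {x : ℕ → Fin ℓ → ℝ} {T : ℕ}

lemma chainExp_last (h0 : q = x 0)
    (hx : ∀ t < T, ∀ j, ∑ i, x t i * K (t + 1) i j = x (t + 1) j) {n : ℕ} (hn : n ≤ T)
    (ψ : Fin ℓ → ℝ) : chainExp q K n (fun r => ψ (r n)) = ∑ i, x n i * ψ i := by
  induction n generalizing ψ with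
  | zero =>
    unfold chainExp
    rw [← (Equiv.funUnique (Fin 1) (Fin ℓ)).symm.sum_comp]
    simp [extendPath, h0]
  | succ n ih =>
    rw [chainExp_succ]
    simp only [Function.update_self]
    rw [ih (by omega) fun i => ∑ j, K (n + 1) i j * ψ j]
    simp only [Finset.mul_sum]
    rw [Finset.sum_comm]
    refine Finset.sum_congr rfl fun j _ => ?_
    rw [← hx n (by omega) j, Finset.sum_mul]
    exact Finset.sum_congr rfl fun i _ => by ring

/-- The rows of the later transition matrices sum to one, so the coordinates after n integrate out.
-/
lemma chainExp_restrict (hK : ∀ t < T, ∀ i, ∑ j, K (t + 1) i j = 1) {n N : ℕ} (hn : n ≤ N)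
    (hN : N ≤ T) {g : (ℕ → Fin ℓ) → ℝ} (hg : ∀ r r', (∀ t ≤ n, r t = r' t) → g r = g r') :
    chainExp q K N g = chainExp q K n g := by
  induction N, hn using Nat.le_induction with
  | base => rfl
  | succ N h ih =>
    rw [chainExp_succ, ← ih (by omega)]
    congr 1
    funext r
    have : ∀ j, g (Function.update r (N + 1) j) = g r := fun j =>
      hg _ _ fun t ht => Function.update_of_ne (by omega) _ _
    simp only [this, ← Finset.sum_mul, hK N (by omega), one_mul]

lemma chainExp_state (h0 : q = x 0)
    (hx : ∀ t < T, ∀ j, ∑ i, x t i * K (t + 1) i j = x (t + 1) j)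
    (hK : ∀ t < T, ∀ i, ∑ j, K (t + 1) i j = 1) {n : ℕ} (hn : n ≤ T) (ψ : Fin ℓ → ℝ) :
    chainExp q K T (fun r => ψ (r n)) = ∑ i, x n i * ψ i := by
  rw [← chainExp_last h0 hx hn]
  exact chainExp_restrict hK hn le_rfl fun r r' h => by rw [h n le_rfl]

/-- With ψ the indicator of a switch, this turns the switching probability into the mass moved by
the transport plan. -/
lemma chainExp_transition (h0 : q = x 0)
    (hx : ∀ t < T, ∀ j, ∑ i, x t i * K (t + 1) i j = x (t + 1) j)
    (hK : ∀ t < T, ∀ i, ∑ j, K (t + 1) i j = 1) {n : ℕ} (hn : n + 1 ≤ T)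
    (ψ : Fin ℓ → Fin ℓ → ℝ) :
    chainExp q K T (fun r => ψ (r n) (r (n + 1))) =
      ∑ i, x n i * ∑ j, K (n + 1) i j * ψ i j := by
  rw [chainExp_restrict hK hn le_rfl fun r r' h => by rw [h n (by omega), h (n + 1) le_rfl],
    chainExp_succ, ← chainExp_last h0 hx (by omega : n ≤ T)]
  congr 1
  funext r
  refine Finset.sum_congr rfl fun j _ => ?_
  rw [Function.update_self, Function.update_of_ne (by omega)]

lemma chainExp_add (n : ℕ) (g g' : (ℕ → Fin ℓ) → ℝ) :
    chainExp q K n (fun r => g r + g' r) = chainExp q K n g + chainExp q K n g' := by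
  unfold chainExp
  simp only [mul_add, Finset.sum_add_distrib]

lemma chainExp_mul_left (n : ℕ) (c : ℝ) (g : (ℕ → Fin ℓ) → ℝ) :
    chainExp q K n (fun r => c * g r) = c * chainExp q K n g := by
  unfold chainExp
  rw [Finset.mul_sum]
  exact Finset.sum_congr rfl fun _ _ => by ring

lemma chainExp_sum {ι : Type*} (s : Finset ι) (n : ℕ) (g : ι → (ℕ → Fin ℓ) → ℝ) :
    chainExp q K n (fun r => ∑ i ∈ s, g i r) = ∑ i ∈ s, chainExp q K n (g i) := by
  unfold chainExp
  simp only [Finset.mul_sum]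
  rw [Finset.sum_comm]

end Chain

/-! ### Rounding -/

section Round

variable {ℓ : ℕ} {τ : (Fin ℓ → ℝ) → (Fin ℓ → ℝ) → Fin ℓ → Fin ℓ → ℝ} {p p' : Fin ℓ → ℝ}

lemma roundProb_self (p : Fin ℓ → ℝ) (i j : Fin ℓ) :
    roundProb τ p p i j = if j = i then 1 else 0 := by simp [roundProb]

lemma roundProb_nonneg (hτ : IsOptimalPlan τ) (hp : p ∈ stdSimplex ℝ (Fin ℓ))
    (hp' : p' ∈ stdSimplex ℝ (Fin ℓ)) (i j : Fin ℓ) : 0 ≤ roundProb τ p p' i j := by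
  unfold roundProb
  split_ifs
  exacts [zero_le_one, le_rfl, div_nonneg (hτ.nonneg p hp p' hp' i j) (hp.1 i)]

lemma sum_roundProb (hτ : IsOptimalPlan τ) (hp : p ∈ stdSimplex ℝ (Fin ℓ))
    (hp' : p' ∈ stdSimplex ℝ (Fin ℓ)) {i : Fin ℓ} (hi : 0 < p i) :
    ∑ j, roundProb τ p p' i j = 1 := by
  unfold roundProb
  split_ifs
  · simp
  · rw [← Finset.sum_div, hτ.source p hp p' hp' i, div_self hi.ne']

lemma mul_roundProb (hi : ∀ i, 0 < p i) (h : p' ≠ p) (i j : Fin ℓ) :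
    p i * roundProb τ p p' i j = τ p p' i j := by
  rw [roundProb, if_neg h, mul_div_cancel₀ _ (hi i).ne']

lemma sum_mul_roundProb (hτ : IsOptimalPlan τ) (hp : p ∈ stdSimplex ℝ (Fin ℓ))
    (hp' : p' ∈ stdSimplex ℝ (Fin ℓ)) (hi : ∀ i, 0 < p i) (j : Fin ℓ) :
    ∑ i, p i * roundProb τ p p' i j = p' j := by
  by_cases h : p' = p
  · subst h; simp [roundProb_self]
  · simp only [mul_roundProb hi h, hτ.target p hp p' hp' j]

lemma sum_roundProb_switch (hτ : IsOptimalPlan τ) (hp : p ∈ stdSimplex ℝ (Fin ℓ))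
    (hp' : p' ∈ stdSimplex ℝ (Fin ℓ)) (hi : ∀ i, 0 < p i) :
    ∑ i, p i * ∑ j, roundProb τ p p' i j * (if i = j then 0 else 1) =
      ∑ i, max 0 (p i - p' i) := by
  by_cases h : p' = p
  · subst h
    simp only [roundProb_self, sub_self, max_self, Finset.sum_const_zero]
    refine Finset.sum_eq_zero fun i _ => mul_eq_zero_of_right _ (Finset.sum_eq_zero fun j _ => ?_)
    by_cases hij : i = j
    · rw [if_pos hij, mul_zero]
    · rw [if_neg (Ne.symm hij), zero_mul]
  · rw [← hτ.optimal p hp p' hp']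
    refine Finset.sum_congr rfl fun i _ => ?_
    rw [Finset.mul_sum]
    refine Finset.sum_congr rfl fun j _ => ?_
    rw [← mul_assoc, mul_roundProb hi h]
    split_ifs <;> simp

end Round

/-! ### The learner SHARE -/

section Share

variable {ℓ : ℕ} {η α : ℝ} {w g : Fin ℓ → ℝ}

/-- The weight removed from the experts by the losses `g`, before sharing. -/
noncomputable def lostWeight (η : ℝ) (w g : Fin ℓ → ℝ) : ℝ :=
  ∑ j, w j * (1 - Real.exp (-η * g j))

lemma shareUpdate_eq (η α : ℝ) (w g : Fin ℓ → ℝ) (i : Fin ℓ) :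
    shareUpdate η α w g i = w i * Real.exp (-η * g i) + α / ℓ * lostWeight η w g := by
  unfold shareUpdate lostWeight
  rw [show ∑ j, (w j - Real.exp (-η * g j) * w j) = ∑ j, w j * (1 - Real.exp (-η * g j)) from
    Finset.sum_congr rfl fun j _ => by ring]
  ring

lemma shareUpdate_zero (η α : ℝ) (w : Fin ℓ → ℝ) : shareUpdate η α w (fun _ => 0) = w := by
  funext i; simp [shareUpdate]

lemma lostWeight_nonneg (hη : 0 ≤ η) (hw : ∀ i, 0 ≤ w i) (hg : ∀ i, 0 ≤ g i) :
    0 ≤ lostWeight η w g := by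
  refine Finset.sum_nonneg fun j _ => mul_nonneg (hw j) (sub_nonneg.2 ?_)
  rw [Real.exp_le_one_iff]
  nlinarith [hg j]

lemma shareUpdate_pos (hη : 0 ≤ η) (hα : 0 ≤ α) (hw : ∀ i, 0 < w i) (hg : ∀ i, 0 ≤ g i)
    (i : Fin ℓ) : 0 < shareUpdate η α w g i := by
  rw [shareUpdate_eq]
  have := lostWeight_nonneg hη (fun i => (hw i).le) hg
  have := mul_pos (hw i) (Real.exp_pos (-η * g i))
  positivity

lemma sum_shareUpdate [NeZero ℓ] (η α : ℝ) (w g : Fin ℓ → ℝ) :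
    ∑ i, shareUpdate η α w g i = ∑ i, w i - (1 - α) * lostWeight η w g := by
  simp only [shareUpdate_eq, Finset.sum_add_distrib, Finset.sum_const, Finset.card_univ,
    Fintype.card_fin, nsmul_eq_mul]
  have h : ∑ i, w i * Real.exp (-η * g i) = ∑ i, w i - lostWeight η w g := by
    rw [lostWeight, ← Finset.sum_sub_distrib]
    exact Finset.sum_congr rfl fun i _ => by ring
  have : (ℓ : ℝ) ≠ 0 := NeZero.ne _
  rw [h]
  field_simp
  ring

/-- The exponential lies below its chord between -η and 0. -/
lemma one_sub_exp_bounds {γ u : ℝ} (hγ : γ = 1 - Real.exp (-η)) (h0 : 0 ≤ u) (h1 : u ≤ 1) :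
    γ * u ≤ 1 - Real.exp (-η * u) := by
  have h := convexOn_exp.2 (Set.mem_univ (-η)) (Set.mem_univ 0) h0 (sub_nonneg.2 h1)
    (by ring)
  simp only [smul_eq_mul, mul_zero, add_zero, Real.exp_zero, mul_one] at h
  rw [show -η * u = u * -η by ring, hγ]
  linarith

lemma le_lostWeight {γ : ℝ} (hγ : γ = 1 - Real.exp (-η)) (hw : ∀ i, 0 ≤ w i)
    (h0 : ∀ i, 0 ≤ g i) (h1 : ∀ i, g i ≤ 1) : γ * ∑ i, w i * g i ≤ lostWeight η w g := by
  rw [Finset.mul_sum]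
  refine Finset.sum_le_sum fun i _ => ?_
  have := mul_le_mul_of_nonneg_left (one_sub_exp_bounds hγ (h0 i) (h1 i)) (hw i)
  linarith

lemma lostWeight_le (hw : ∀ i, 0 ≤ w i) : lostWeight η w g ≤ η * ∑ i, w i * g i := by
  rw [Finset.mul_sum]
  refine Finset.sum_le_sum fun i _ => ?_
  have h := Real.add_one_le_exp (-η * g i)
  nlinarith [hw i]

lemma lostWeight_le_mul_sum {γ : ℝ} (hγ : γ = 1 - Real.exp (-η)) (hη : 0 ≤ η)
    (hw : ∀ i, 0 ≤ w i) (h1 : ∀ i, g i ≤ 1) : lostWeight η w g ≤ γ * ∑ i, w i := by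
  rw [Finset.mul_sum]
  refine Finset.sum_le_sum fun i _ => ?_
  have h : Real.exp (-η) ≤ Real.exp (-η * g i) := Real.exp_le_exp.2 (by nlinarith [h1 i])
  rw [hγ]
  nlinarith [hw i]

/-- The distribution proportional to the weights `w`. -/
noncomputable def normalized (w : Fin ℓ → ℝ) (i : Fin ℓ) : ℝ := w i / ∑ j, w j

lemma sum_pos_of_pos [NeZero ℓ] (hw : ∀ i, 0 < w i) : 0 < ∑ i, w i :=
  Finset.sum_pos (fun i _ => hw i) Finset.univ_nonempty

lemma normalized_pos [NeZero ℓ] (hw : ∀ i, 0 < w i) (i : Fin ℓ) : 0 < normalized w i :=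
  div_pos (hw i) (sum_pos_of_pos hw)

lemma normalized_mem [NeZero ℓ] (hw : ∀ i, 0 < w i) : normalized w ∈ stdSimplex ℝ (Fin ℓ) := by
  refine ⟨fun i => (normalized_pos hw i).le, ?_⟩
  simp only [normalized]
  rw [← Finset.sum_div, div_self (sum_pos_of_pos hw).ne']

lemma sum_normalized_mul (w f : Fin ℓ → ℝ) :
    ∑ i, normalized w i * f i = (∑ i, w i * f i) / ∑ i, w i := by
  rw [Finset.sum_div]
  exact Finset.sum_congr rfl fun i _ => by rw [normalized]; ring

/-- The mass moved by one update is at most `η` times the loss of the learner. -/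
lemma movement_le [NeZero ℓ] (hη : 0 ≤ η) (hα : 0 ≤ α) (hα1 : α ≤ 1) (hw : ∀ i, 0 < w i)
    (hg : ∀ i, 0 ≤ g i) :
    ∑ i, max 0 (normalized w i - normalized (shareUpdate η α w g) i) ≤
      η * ∑ i, normalized w i * g i := by
  have hw' := shareUpdate_pos hη hα hw hg
  have hL := lostWeight_nonneg hη (fun i => (hw i).le) hg
  rw [Finset.mul_sum]
  refine Finset.sum_le_sum fun i _ => ?_
  have hp := normalized_pos hw i
  refine max_le (mul_nonneg hη (mul_nonneg hp.le (hg i))) ?_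
  -- Sharing only adds weight and the total weight never grows, so after normalization a probability
  -- shrinks at most by its own factor exp(-η g).
  have h1 : normalized w i * Real.exp (-η * g i) ≤ normalized (shareUpdate η α w g) i := by
    unfold normalized
    rw [div_mul_eq_mul_div]
    refine div_le_div₀ (hw' i).le ?_ (sum_pos_of_pos hw') ?_
    · rw [shareUpdate_eq]
      have : 0 ≤ α / ℓ * lostWeight η w g := by positivity
      linarith
    · rw [sum_shareUpdate]
      nlinarith
  have h2 := Real.add_one_le_exp (-η * g i)
  nlinarith

/-- One update increases the average of `f` in a controlled way. -/
lemma average_update_le [NeZero ℓ] {γ D : ℝ} (hγ : γ = 1 - Real.exp (-η)) (hγ1 : γ ≤ 3 / 4)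
    (hη : 0 ≤ η) (hα : 0 ≤ α) (hw : ∀ i, 0 < w i)
    (h0 : ∀ i, 0 ≤ g i) (h1 : ∀ i, g i ≤ 1) {f : Fin ℓ → ℝ} (hf0 : ∀ i, 0 ≤ f i)
    (hf : ∀ i, f i ≤ D) :
    ∑ i, normalized (shareUpdate η α w g) i * f i ≤
      4 * (∑ i, normalized w i * f i + α * η * D * ∑ i, normalized w i * g i) := by
  have hw0 : ∀ i, 0 ≤ w i := fun i => (hw i).le
  have hw' := shareUpdate_pos hη hα hw h0
  have hW := sum_pos_of_pos hw
  have hL := lostWeight_nonneg hη hw0 h0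
  have hℓ : (0 : ℝ) < ℓ := Nat.cast_pos.2 (Nat.pos_of_ne_zero (NeZero.ne ℓ))
  have hD : 0 ≤ D := (hf0 0).trans (hf 0)
  rw [sum_normalized_mul, sum_normalized_mul, sum_normalized_mul]
  -- An update removes at most the fraction γ ≤ 3/4 of the total weight; this is where the factor 4
  -- comes from.
  have hden : (∑ i, w i) / 4 ≤ ∑ i, shareUpdate η α w g i := by
    rw [sum_shareUpdate]
    have := lostWeight_le_mul_sum hγ hη hw0 h1
    nlinarith
  -- The shared weight is spread uniformly, so it meets the plain average of `f`, which is at most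
  -- `D`.
  have hnum : ∑ i, shareUpdate η α w g i * f i ≤
      ∑ i, w i * f i + α * η * D * ∑ i, w i * g i := by
    have hs : ∑ i, f i ≤ ℓ * D := by
      simpa using Finset.sum_le_sum fun (i : Fin ℓ) (_ : i ∈ Finset.univ) => hf i
    calc ∑ i, shareUpdate η α w g i * f i
        ≤ ∑ i, (w i * f i + α / ℓ * lostWeight η w g * f i) := by
          refine Finset.sum_le_sum fun i _ => ?_
          rw [shareUpdate_eq, add_mul]
          have : Real.exp (-η * g i) ≤ 1 := Real.exp_le_one_iff.2 (by nlinarith [h0 i])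
          have := mul_le_mul_of_nonneg_left this (hw0 i)
          nlinarith [hf0 i]
      _ = ∑ i, w i * f i + α / ℓ * lostWeight η w g * ∑ i, f i := by
          rw [Finset.sum_add_distrib, Finset.mul_sum]
      _ ≤ ∑ i, w i * f i + α / ℓ * (η * ∑ i, w i * g i) * (ℓ * D) := by
          gcongr
          · exact Finset.sum_nonneg fun i _ => hf0 i
          · have := Finset.sum_nonneg fun i (_ : i ∈ Finset.univ) => mul_nonneg (hw0 i) (h0 i)
            positivity
          · exact lostWeight_le hw0
      _ = _ := by field_simp
  have h4 : 0 ≤ ∑ i, w i * f i + α * η * D * ∑ i, w i * g i :=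
    add_nonneg (Finset.sum_nonneg fun i _ => mul_nonneg (hw0 i) (hf0 i))
      (mul_nonneg (by positivity) (Finset.sum_nonneg fun i _ => mul_nonneg (hw0 i) (h0 i)))
  calc _ ≤ (∑ i, w i * f i + α * η * D * ∑ i, w i * g i) / ((∑ i, w i) / 4) :=
        div_le_div₀ h4 hnum (by positivity) hden
    _ = _ := by field_simp

end Share

/-! ### Regret of SHARE against comparators with few switches -/

section Regret

variable {ℓ : ℕ} [NeZero ℓ] {η α : ℝ} {w g : ℕ → Fin ℓ → ℝ}

/-- Of the weight lost in an update, the fraction 1 - α disappears for good; each step thus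
multiplies the total weight by at most 1 - (1 - α)γz, where z is the learner's loss. -/
lemma weights_sum_upper {γ : ℝ} (hγ : γ = 1 - Real.exp (-η)) (hα1 : α ≤ 1)
    (hu : ∀ t, w (t + 1) = shareUpdate η α (w t) (g t))
    (hw : ∀ t i, 0 < w t i) (h1 : w 1 = fun _ => 1)
    (hg0 : ∀ t i, 0 ≤ g t i) {T : ℕ} (hg1 : ∀ t ∈ Finset.Icc 1 T, ∀ i, g t i ≤ 1) :
    ∑ i, w (T + 1) i ≤ ℓ *
      Real.exp (-((1 - α) * γ * ∑ t ∈ Finset.Icc 1 T, ∑ i, normalized (w t) i * g t i)) := by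
  induction T with
  | zero => simp [h1]
  | succ T ih =>
    have ih := ih fun t ht => hg1 t (by rw [Finset.mem_Icc] at ht ⊢; omega)
    rw [Finset.sum_Icc_succ_top (by omega), mul_add, neg_add, Real.exp_add, ← mul_assoc,
      hu, sum_shareUpdate]
    have hW := sum_pos_of_pos (hw (T + 1))
    have hl := le_lostWeight hγ (fun i => (hw (T + 1) i).le) (hg0 (T + 1))
      (hg1 (T + 1) (by simp))
    set W := ∑ i, w (T + 1) i
    have hx : ∑ i, w (T + 1) i * g (T + 1) i =
        W * ∑ i, normalized (w (T + 1)) i * g (T + 1) i := by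
      rw [sum_normalized_mul, mul_div_cancel₀ _ hW.ne']
    set z := ∑ i, normalized (w (T + 1)) i * g (T + 1) i
    have hexp := Real.add_one_le_exp (-((1 - α) * γ * z))
    calc W - (1 - α) * lostWeight η (w (T + 1)) (g (T + 1))
        ≤ W * (-((1 - α) * γ * z) + 1) := by
          have := mul_le_mul_of_nonneg_left hl (sub_nonneg.2 hα1)
          rw [hx] at this
          linarith
      _ ≤ W * Real.exp (-((1 - α) * γ * z)) := by gcongr
      _ ≤ _ := by gcongr

/-- The invariant behind the regret bound: `B` is the total weight at the beginning of the current
segment of the comparator `i`, and `G` is the loss of the comparator since then. -/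
lemma weights_sum_lower (hη : 0 ≤ η) (hα : 0 < α) (hα1 : α ≤ 1)
    (hu : ∀ t, w (t + 1) = shareUpdate η α (w t) (g t))
    (hw : ∀ t i, 0 < w t i) (h1 : w 1 = fun _ => 1)
    (hg0 : ∀ t i, 0 ≤ g t i) (i : ℕ → Fin ℓ) (T : ℕ) :
    ∃ B G : ℝ, ∑ j, w (T + 1) j ≤ B ∧
      α / ℓ * (B - ∑ j, w (T + 1) j) * Real.exp (-η * G) ≤ w (T + 1) (i T) ∧ 0 ≤ G ∧
      ℓ * (α / (2 * ℓ)) ^ ((Finset.Icc 2 T).filter fun t => i (t - 1) ≠ i t).card *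
        Real.exp (-η * (∑ t ∈ Finset.Icc 1 T, g t (i t) - G)) ≤ B := by
  have hℓ : (1 : ℝ) ≤ ℓ := Nat.one_le_cast.2 (Nat.pos_of_ne_zero (NeZero.ne ℓ))
  have hαℓ : α / ℓ ≤ 1 := (div_le_one (by linarith)).2 (by linarith)
  have hαℓ0 : 0 < α / ℓ := by positivity
  induction T with
  | zero =>
    refine ⟨ℓ, 0, by simp [h1], ?_, le_rfl, by simp⟩
    simp [h1]
  | succ T ih =>
    obtain ⟨B, G, hB, hw1, hG, hB2⟩ := ih
    -- the update, for a comparator which satisfies the invariant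
    have step : ∀ B' G' : ℝ, ∑ j, w (T + 1) j ≤ B' → 0 ≤ G' →
        α / ℓ * (B' - ∑ j, w (T + 1) j) * Real.exp (-η * G') ≤ w (T + 1) (i (T + 1)) →
        ∑ j, w (T + 1 + 1) j ≤ B' ∧
        α / ℓ * (B' - ∑ j, w (T + 1 + 1) j) * Real.exp (-η * (G' + g (T + 1) (i (T + 1)))) ≤
          w (T + 1 + 1) (i (T + 1)) := by
      intro B' G' hB' hG' hle
      have hL := lostWeight_nonneg hη (fun j => (hw (T + 1) j).le) (hg0 (T + 1))
      rw [hu (T + 1), sum_shareUpdate, shareUpdate_eq]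
      set L := lostWeight η (w (T + 1)) (g (T + 1))
      set W := ∑ j, w (T + 1) j
      set gi := g (T + 1) (i (T + 1))
      have hgi : 0 ≤ gi := hg0 _ _
      refine ⟨by nlinarith, ?_⟩
      have he : Real.exp (-η * (G' + gi)) ≤ 1 :=
        Real.exp_le_one_iff.2 (by nlinarith [mul_nonneg hη (add_nonneg hG' hgi)])
      have he' : Real.exp (-η * (G' + gi)) = Real.exp (-η * G') * Real.exp (-η * gi) := by
        rw [mul_add, Real.exp_add]
      -- The deficit B' - W grows by (1 - α)L while every expert receives the share αL/ℓ, so the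
      -- comparator keeps pace with its lower bound.
      calc α / ℓ * (B' - (W - (1 - α) * L)) * Real.exp (-η * (G' + gi))
          = α / ℓ * (B' - W) * Real.exp (-η * G') * Real.exp (-η * gi) +
            α / ℓ * ((1 - α) * L * Real.exp (-η * (G' + gi))) := by rw [he']; ring
        _ ≤ w (T + 1) (i (T + 1)) * Real.exp (-η * gi) + α / ℓ * (1 * L * 1) := by
            gcongr
            linarith
        _ = _ := by ring
    rw [Finset.sum_Icc_succ_top (by omega)]
    by_cases hsw : 2 ≤ T + 1 ∧ i T ≠ i (T + 1)
    · -- a new segment begins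
      have hcard : ((Finset.Icc 2 (T + 1)).filter fun t => i (t - 1) ≠ i t).card =
          ((Finset.Icc 2 T).filter fun t => i (t - 1) ≠ i t).card + 1 := by
        rw [← Finset.insert_Icc_right_eq_Icc_add_one hsw.1, Finset.filter_insert,
          if_pos (by simpa using hsw.2), Finset.card_insert_of_notMem (by simp)]
      -- The invariant restarts with the present total weight and zero loss; since the deficit is
      -- then zero, nothing is required of the new comparator.
      obtain ⟨s1, s2⟩ := step (∑ j, w (T + 1) j) 0 le_rfl le_rfl
        (by simpa using (hw (T + 1) (i (T + 1))).le)
      refine ⟨∑ j, w (T + 1) j, 0 + g (T + 1) (i (T + 1)), s1, s2,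
        by simpa using hg0 _ _, ?_⟩
      rw [hcard]
      have hle : w (T + 1) (i T) ≤ ∑ j, w (T + 1) j :=
        Finset.single_le_sum (fun j _ => (hw (T + 1) j).le) (Finset.mem_univ _)
      set W := ∑ j, w (T + 1) j
      have he : Real.exp (-η * G) ≤ 1 :=
        Real.exp_le_one_iff.2 (by nlinarith [mul_nonneg hη hG])
      have hWpos : 0 < W := (hw _ _).trans_le hle
      -- W dominates the comparator's weight, which is at least α/ℓ times the discounted deficit B -
      -- W, and trivially α/ℓ times the discounted W. Averaging both bounds eliminates the deficit
      -- and makes a switch cost a factor α/(2ℓ).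
      have hWB : α / (2 * ℓ) * B * Real.exp (-η * G) ≤ W := by
        have h2 : α / ℓ * W * Real.exp (-η * G) ≤ 1 * W * 1 := by gcongr
        have h3 : α / (2 * ℓ) * B * Real.exp (-η * G) =
          (α / ℓ * (B - W) * Real.exp (-η * G) + α / ℓ * W * Real.exp (-η * G)) / 2 := by
          field_simp; ring
        rw [h3]
        linarith
      refine le_trans ?_ hWB
      set k := ((Finset.Icc 2 T).filter fun t => i (t - 1) ≠ i t).card
      calc _ = α / (2 * ℓ) * (ℓ * (α / (2 * ℓ)) ^ k *
            Real.exp (-η * (∑ t ∈ Finset.Icc 1 T, g t (i t) - G))) * Real.exp (-η * G) := by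
            rw [show -η * (∑ t ∈ Finset.Icc 1 T, g t (i t) + g (T + 1) (i (T + 1)) -
              (0 + g (T + 1) (i (T + 1)))) =
              -η * (∑ t ∈ Finset.Icc 1 T, g t (i t) - G) + -η * G by ring, Real.exp_add, pow_succ]
            ring
        _ ≤ _ := by gcongr
    · have hcard : ((Finset.Icc 2 (T + 1)).filter fun t => i (t - 1) ≠ i t).card =
          ((Finset.Icc 2 T).filter fun t => i (t - 1) ≠ i t).card := by
        by_cases h2 : 2 ≤ T + 1
        · rw [← Finset.insert_Icc_right_eq_Icc_add_one h2, Finset.filter_insert,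
            if_neg (by simpa [h2] using hsw)]
        · rw [Finset.Icc_eq_empty (by omega), Finset.Icc_eq_empty (by omega)]
      have hle : α / ℓ * (B - ∑ j, w (T + 1) j) * Real.exp (-η * G) ≤
          w (T + 1) (i (T + 1)) := by
        by_cases h2 : 2 ≤ T + 1
        · rwa [show i (T + 1) = i T by by_contra h; exact hsw ⟨h2, fun h' => h h'.symm⟩]
        -- All weights at time 1 are equal, so passing from `i 0` to `i 1` is free.
        · obtain rfl : T = 0 := by omega
          simpa [h1] using hw1
      obtain ⟨s1, s2⟩ := step B G hB hG hle
      refine ⟨B, G + g (T + 1) (i (T + 1)), s1, s2, add_nonneg hG (hg0 _ _), ?_⟩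
      rw [hcard, add_sub_add_right_eq_sub]
      exact hB2

/-- The regret of SHARE against a comparator with few switches. -/
theorem share_regret {γ : ℝ} (hγ : γ = 1 - Real.exp (-η)) (hη : 0 ≤ η) (hα : 0 < α) (hα1 : α ≤ 1)
    (hu : ∀ t, w (t + 1) = shareUpdate η α (w t) (g t))
    (hw : ∀ t i, 0 < w t i) (h1 : w 1 = fun _ => 1)
    (hg0 : ∀ t i, 0 ≤ g t i) {T : ℕ}
    (hg1 : ∀ t ∈ Finset.Icc 1 T, ∀ i, g t i ≤ 1) (i : ℕ → Fin ℓ) {k : ℕ}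
    (hk : ((Finset.Icc 2 T).filter fun t => i (t - 1) ≠ i t).card ≤ k) :
    (1 - α) * γ * ∑ t ∈ Finset.Icc 1 T, ∑ j, normalized (w t) j * g t j ≤
      η * ∑ t ∈ Finset.Icc 1 T, g t (i t) + (k + 1) * Real.log (2 * ℓ / α) := by
  have hℓ : (1 : ℝ) ≤ ℓ := Nat.one_le_cast.2 (Nat.pos_of_ne_zero (NeZero.ne ℓ))
  obtain ⟨B, G, hB, hw1, hG, hB2⟩ := weights_sum_lower hη hα hα1 hu hw h1 hg0 i T
  have hup := weights_sum_upper hγ hα1 hu hw h1 hg0 hg1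
  have hle : w (T + 1) (i T) ≤ ∑ j, w (T + 1) j :=
    Finset.single_le_sum (fun j _ => (hw (T + 1) j).le) (Finset.mem_univ _)
  have hWpos : 0 < ∑ j, w (T + 1) j := (hw _ _).trans_le hle
  set W := ∑ j, w (T + 1) j
  set R := ∑ t ∈ Finset.Icc 1 T, ∑ j, normalized (w t) j * g t j
  set F := ∑ t ∈ Finset.Icc 1 T, g t (i t)
  set K := ((Finset.Icc 2 T).filter fun t => i (t - 1) ≠ i t).card
  have hαℓ : α / ℓ ≤ 1 := (div_le_one (by linarith)).2 (by linarith)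
  have he : Real.exp (-η * G) ≤ 1 :=
    Real.exp_le_one_iff.2 (by nlinarith [mul_nonneg hη hG])
  have hWB : α / (2 * ℓ) * B * Real.exp (-η * G) ≤ W := by
    have h2 : α / ℓ * W * Real.exp (-η * G) ≤ 1 * W * 1 := by gcongr
    have h3 : α / (2 * ℓ) * B * Real.exp (-η * G) =
      (α / ℓ * (B - W) * Real.exp (-η * G) + α / ℓ * W * Real.exp (-η * G)) / 2 := by
      field_simp; ring
    rw [h3]
    linarith
  have hfin : ℓ * ((α / (2 * ℓ)) ^ (K + 1) * Real.exp (-η * F)) ≤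
      ℓ * Real.exp (-((1 - α) * γ * R)) := by
    refine le_trans ?_ (hWB.trans hup)
    calc _ = α / (2 * ℓ) * (ℓ * (α / (2 * ℓ)) ^ K * Real.exp (-η * (F - G))) *
          Real.exp (-η * G) := by
          rw [show -η * F = -η * (F - G) + -η * G by ring, Real.exp_add, pow_succ]; ring
      _ ≤ _ := by gcongr
  have hpos : 0 < α / (2 * ℓ) := by positivity
  have hlog := Real.log_le_log (by positivity) (le_of_mul_le_mul_left hfin (by linarith))
  rw [Real.log_exp, Real.log_mul (by positivity) (by positivity), Real.log_pow, Real.log_exp] at hlog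
  have hinv : Real.log (2 * ℓ / α) = - Real.log (α / (2 * ℓ)) := by
    rw [← Real.log_inv, inv_div]
  have hlnn : 0 ≤ Real.log (2 * ℓ / α) := Real.log_nonneg ((one_le_div hα).2 (by linarith))
  have hK : ((K : ℝ) + 1) * Real.log (2 * ℓ / α) ≤ (k + 1) * Real.log (2 * ℓ / α) := by
    gcongr
  push_cast at hlog
  rw [hinv] at hK ⊢
  linarith

end Regret

/-! ### Expectations over the coins and the explored heuristics -/

/-- Resampling one coordinate preserves a product measure; all independence statements below are
derived from this. -/
lemma sum_prod_resample {ι κ : Type*} [Fintype ι] [DecidableEq ι] [Fintype κ] (p : ι → κ → ℝ)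
    (s : ι) (hp : ∑ c, p s c = 1) (F : (ι → κ) → ℝ) :
    ∑ b : ι → κ, (∏ i, p i (b i)) * F b =
      ∑ b : ι → κ, (∏ i, p i (b i)) * ∑ c, p s c * F (Function.update b s c) := by
  have hsplit : ∀ G : (ι → κ) → ℝ, ∑ b, G b =
      ∑ b' : {j // j ≠ s} → κ, ∑ c, G ((Equiv.funSplitAt s κ).symm (c, b')) := by
    intro G
    rw [← (Equiv.funSplitAt s κ).symm.sum_comp, Fintype.sum_prod_type, Finset.sum_comm]
  have hprod : ∀ c b', ∏ i, p i ((Equiv.funSplitAt s κ).symm (c, b') i) =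
      p s c * ∏ i : {j // j ≠ s}, p i (b' i) := by
    intro c b'
    rw [Fintype.prod_eq_mul_prod_subtype_ne _ s]
    congr 1
    · simp [Equiv.funSplitAt, Equiv.piSplitAt]
    · refine Finset.prod_congr rfl fun i _ => ?_
      simp [Equiv.funSplitAt, Equiv.piSplitAt, i.2]
  have hupd : ∀ c c' b', Function.update ((Equiv.funSplitAt s κ).symm (c', b')) s c =
      (Equiv.funSplitAt s κ).symm (c, b') := by
    intro c c' b'
    funext j
    by_cases hj : j = s
    · subst hj; simp [Equiv.funSplitAt, Equiv.piSplitAt]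
    · simp [Equiv.funSplitAt, Equiv.piSplitAt, hj]
  rw [hsplit, hsplit]
  refine Finset.sum_congr rfl fun b' _ => ?_
  simp only [hprod, hupd]
  rw [← Finset.sum_mul, ← Finset.sum_mul, hp, one_mul, Finset.mul_sum]
  exact Finset.sum_congr rfl fun c _ => by ring

section Expect

/-- The coins as a function of all times. -/
def extendCoins {T : ℕ} (b : Fin T → Bool) (t : ℕ) : Bool :=
  if h : 1 ≤ t ∧ t ≤ T then b ⟨t - 1, by omega⟩ else false

variable {ℓ : ℕ}

/-- The explored heuristics as a function of all times. -/
def extendExplored [NeZero ℓ] {N : ℕ} (v : Fin N → Fin ℓ) (t : ℕ) : Fin ℓ :=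
  if h : 1 ≤ t ∧ t ≤ N then v ⟨t - 1, by omega⟩ else 0

/-- The expectation of a function of the coins and of the explored heuristics. -/
noncomputable def coinExp [NeZero ℓ] (T N : ℕ) (ε : ℝ) (φ : (ℕ → Bool) → (ℕ → Fin ℓ) → ℝ) : ℝ :=
  ∑ b : Fin T → Bool, (∏ i, if b i then ε else 1 - ε) *
    ∑ v : Fin N → Fin ℓ, (∏ _i : Fin N, 1 / (ℓ : ℝ)) * φ (extendCoins b) (extendExplored v)

/-- `φ` depends only on what happens before time `t`. -/
def DependsOnPast (t : ℕ) (φ : (ℕ → Bool) → (ℕ → Fin ℓ) → ℝ) : Prop :=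
  ∀ β β' e e', (∀ s < t, β s = β' s) → (∀ s < t, e s = e' s) → φ β e = φ β' e'

lemma DependsOnPast.mono {s t : ℕ} {φ : (ℕ → Bool) → (ℕ → Fin ℓ) → ℝ} (h : DependsOnPast s φ)
    (hst : s ≤ t) : DependsOnPast t φ := fun β β' e e' hβ he =>
  h β β' e e' (fun i hi => hβ i (by omega)) fun i hi => he i (by omega)

lemma DependsOnPast.mul {t : ℕ} {φ φ' : (ℕ → Bool) → (ℕ → Fin ℓ) → ℝ} (h : DependsOnPast t φ)
    (h' : DependsOnPast t φ') : DependsOnPast t fun β e => φ β e * φ' β e :=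
  fun β β' e e' hβ he => by
    change φ β e * φ' β e = φ β' e' * φ' β' e'
    rw [h β β' e e' hβ he, h' β β' e e' hβ he]

lemma DependsOnPast.add {t : ℕ} {φ φ' : (ℕ → Bool) → (ℕ → Fin ℓ) → ℝ} (h : DependsOnPast t φ)
    (h' : DependsOnPast t φ') : DependsOnPast t fun β e => φ β e + φ' β e :=
  fun β β' e e' hβ he => by
    change φ β e + φ' β e = φ β' e' + φ' β' e'
    rw [h β β' e e' hβ he, h' β β' e e' hβ he]

variable [NeZero ℓ] {T N : ℕ} {ε : ℝ} {φ φ' : (ℕ → Bool) → (ℕ → Fin ℓ) → ℝ}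

lemma coinExp_mono (h0 : 0 ≤ ε) (h1 : ε ≤ 1) (h : ∀ β e, β 0 = false → φ β e ≤ φ' β e) :
    coinExp T N ε φ ≤ coinExp T N ε φ' := by
  unfold coinExp
  refine Finset.sum_le_sum fun b _ => mul_le_mul_of_nonneg_left
    (Finset.sum_le_sum fun v _ => mul_le_mul_of_nonneg_left (h _ _ ?_) ?_) ?_
  · simp [extendCoins]
  · positivity
  · refine Finset.prod_nonneg fun i _ => ?_
    split_ifs <;> linarith

lemma coinExp_congr (h : ∀ β e, β 0 = false → φ β e = φ' β e) :
    coinExp T N ε φ = coinExp T N ε φ' := by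
  unfold coinExp
  refine Finset.sum_congr rfl fun b _ => congrArg _ (Finset.sum_congr rfl fun v _ => ?_)
  rw [h _ _ (by simp [extendCoins])]

lemma coinExp_add (φ φ' : (ℕ → Bool) → (ℕ → Fin ℓ) → ℝ) :
    coinExp T N ε (fun β e => φ β e + φ' β e) = coinExp T N ε φ + coinExp T N ε φ' := by
  unfold coinExp
  simp only [mul_add, Finset.sum_add_distrib]

lemma coinExp_mul_left (c : ℝ) (φ : (ℕ → Bool) → (ℕ → Fin ℓ) → ℝ) :
    coinExp T N ε (fun β e => c * φ β e) = c * coinExp T N ε φ := by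
  unfold coinExp
  simp only [Finset.mul_sum]
  exact Finset.sum_congr rfl fun _ _ => Finset.sum_congr rfl fun _ _ => by ring

lemma coinExp_sum {ι : Type*} (s : Finset ι) (φ : ι → (ℕ → Bool) → (ℕ → Fin ℓ) → ℝ) :
    coinExp T N ε (fun β e => ∑ i ∈ s, φ i β e) = ∑ i ∈ s, coinExp T N ε (φ i) := by
  unfold coinExp
  rw [Finset.sum_comm]
  refine Finset.sum_congr rfl fun b _ => ?_
  rw [← Finset.mul_sum, Finset.sum_comm]
  simp only [Finset.mul_sum]

lemma coinExp_const (c : ℝ) : coinExp T N ε (fun _ (_ : ℕ → Fin ℓ) => c) = c := by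
  have h1 : ∑ b : Fin T → Bool, ∏ i, (if b i then ε else 1 - ε) = 1 := by
    rw [← Fintype.prod_sum fun (_ : Fin T) (c : Bool) => if c then ε else 1 - ε]
    simp
  have h2 : ∑ _v : Fin N → Fin ℓ, (∏ _i : Fin N, 1 / (ℓ : ℝ)) * c = c := by
    have : (ℓ : ℝ) ≠ 0 := NeZero.ne _
    simp
    field_simp
  unfold coinExp
  simp only [h2]
  rw [← Finset.sum_mul, h1, one_mul]

lemma coinExp_nonneg (h0 : 0 ≤ ε) (h1 : ε ≤ 1) (h : ∀ β e, β 0 = false → 0 ≤ φ β e) :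
    0 ≤ coinExp T N ε φ :=
  (coinExp_const (T := T) (N := N) (ε := ε) (ℓ := ℓ) 0).symm.le.trans (coinExp_mono h0 h1 h)

lemma coinExp_coin {s : ℕ} (hs : 1 ≤ s) (hs' : s ≤ T) (hφ : DependsOnPast s φ) (ψ : Bool → ℝ) :
    coinExp T N ε (fun β e => ψ (β s) * φ β e) =
      (ε * ψ true + (1 - ε) * ψ false) * coinExp T N ε φ := by
  unfold coinExp
  rw [sum_prod_resample (fun (_ : Fin T) (c : Bool) => if c then ε else 1 - ε) ⟨s - 1, by omega⟩
    (by simp), Finset.mul_sum]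
  refine Finset.sum_congr rfl fun b _ => ?_
  have hval : ∀ c, extendCoins (Function.update b ⟨s - 1, by omega⟩ c) s = c := fun c => by
    simp [extendCoins, hs, hs']
  have hpast : ∀ c (v : Fin N → Fin ℓ), φ (extendCoins (Function.update b ⟨s - 1, by omega⟩ c))
      (extendExplored v) = φ (extendCoins b) (extendExplored v) := by
    refine fun c v => hφ _ _ _ _ (fun t ht => ?_) fun _ _ => rfl
    unfold extendCoins
    split_ifs with h
    · rw [Function.update_of_ne]
      simp only [ne_eq, Fin.mk.injEq]
      omega
    · rfl
  have hswap : ∀ c, ∑ v : Fin N → Fin ℓ, (∏ _i : Fin N, 1 / (ℓ : ℝ)) *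
      (ψ c * φ (extendCoins b) (extendExplored v)) =
      ψ c * ∑ v : Fin N → Fin ℓ, (∏ _i : Fin N, 1 / (ℓ : ℝ)) *
        φ (extendCoins b) (extendExplored v) := fun c => by
    rw [Finset.mul_sum]; exact Finset.sum_congr rfl fun _ _ => by ring
  simp only [Fintype.sum_bool, hval, hpast, hswap, if_true, Bool.false_eq_true, if_false]
  ring

/-- Only an inequality, because the coins after time `T` are `false` by default. -/
lemma coinExp_coin_le (h0 : 0 ≤ ε) (h1 : ε ≤ 1) {s : ℕ} (hs : 1 ≤ s) (hφ : DependsOnPast s φ)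
    (hφ0 : ∀ β e, 0 ≤ φ β e) :
    coinExp T N ε (fun β e => (if β s then 1 else 0) * φ β e) ≤ ε * coinExp T N ε φ := by
  by_cases hs' : s ≤ T
  · rw [coinExp_coin hs hs' hφ fun c => if c then 1 else 0]
    simp
  · have : coinExp T N ε (fun β e => (if β s then 1 else 0) * φ β e) = 0 := by
      unfold coinExp
      refine Finset.sum_eq_zero fun b _ => mul_eq_zero_of_right _ ?_
      refine Finset.sum_eq_zero fun v _ => ?_
      simp [extendCoins, hs']
    rw [this]
    exact mul_nonneg h0 (coinExp_nonneg h0 h1 fun β e _ => hφ0 β e)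

/-- The heuristic explored at time `s` is uniform and independent of the rest. -/
lemma coinExp_explored {s : ℕ} (hs : 1 ≤ s) (hs' : s ≤ N)
    {Ψ : (ℕ → Bool) → (ℕ → Fin ℓ) → Fin ℓ → ℝ}
    (hΨ : ∀ β e e' i, (∀ t ≠ s, e t = e' t) → Ψ β e i = Ψ β e' i) :
    coinExp T N ε (fun β e => Ψ β e (e s)) =
      (1 / ℓ) * ∑ i, coinExp T N ε (fun β e => Ψ β e i) := by
  have hℓ : (ℓ : ℝ) ≠ 0 := NeZero.ne _
  rw [← coinExp_sum, ← coinExp_mul_left]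
  unfold coinExp
  refine Finset.sum_congr rfl fun b _ => congrArg _ ?_
  rw [sum_prod_resample (fun (_ : Fin N) (_ : Fin ℓ) => 1 / (ℓ : ℝ)) ⟨s - 1, by omega⟩
    (by simp [hℓ])]
  refine Finset.sum_congr rfl fun v _ => congrArg _ ?_
  simp only [Finset.mul_sum]
  refine Finset.sum_congr rfl fun c _ => congrArg _ ?_
  have hval : extendExplored (Function.update v ⟨s - 1, by omega⟩ c) s = c := by
    simp [extendExplored, hs, hs']
  rw [hval]
  refine hΨ _ _ _ _ fun t ht => ?_
  unfold extendExplored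
  split_ifs with h
  · rw [Function.update_of_ne]
    simp only [ne_eq, Fin.mk.injEq]
    omega
  · rfl

end Expect

/-! ### Runs of unsettled steps -/

section Runs

/-- The summand is constant on blocks of length `d`, so this is `d` times a geometric series. -/
lemma sum_pow_div_le {ρ : ℝ} (h0 : 0 ≤ ρ) (h1 : ρ < 1) {d : ℕ} (hd : 0 < d) (n : ℕ) :
    ∑ i ∈ Finset.range n, ρ ^ (i / d) ≤ d / (1 - ρ) := by
  have h2 : (0 : ℝ) < 1 - ρ := by linarith
  have key : ∀ k : ℕ, ∑ i ∈ Finset.range (d * k), ρ ^ (i / d) = d * (1 - ρ ^ k) / (1 - ρ) := by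
    intro k
    induction k with
    | zero => simp
    | succ k ih =>
      rw [mul_add, mul_one, Finset.sum_range_add, ih]
      have : ∀ i ∈ Finset.range d, ρ ^ ((d * k + i) / d) = ρ ^ k := fun i hi => by
        rw [Nat.mul_add_div hd, Nat.div_eq_of_lt (Finset.mem_range.1 hi), add_zero]
      rw [Finset.sum_congr rfl this]
      simp only [Finset.sum_const, Finset.card_range, nsmul_eq_mul]
      field_simp
      ring
  calc _ ≤ ∑ i ∈ Finset.range (d * n), ρ ^ (i / d) := by
        refine Finset.sum_le_sum_of_subset_of_nonneg ?_ fun _ _ _ => by positivity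
        exact Finset.range_mono (Nat.le_mul_of_pos_left n hd)
    _ = d * (1 - ρ ^ n) / (1 - ρ) := key n
    _ ≤ _ := by
        gcongr
        nlinarith [pow_nonneg h0 n, (Nat.cast_nonneg d : (0 : ℝ) ≤ d)]

variable {m : ℕ} {β : ℕ → Bool} {t : ℕ}

/-- One goes back at most m - 2 steps to a step inside a block, and from there at most m steps to
the coin that started it. -/
lemma exists_start_of_unsettled (hm : 1 ≤ m) (h : unsettled m β t ≠ 0) :
    t < m - 1 ∨ ∃ j ∈ Finset.Icc 1 (2 * m), j ≤ t ∧ phase m β (t - j) = 0 ∧ β (t - j) = true := by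
  unfold unsettled at h
  split_ifs at h with h1
  · rcases h1 with h1 | ⟨j, hj, hp⟩
    · exact .inl h1
    · right
      have h2 := phase_le_delay hm β (t - j)
      have h3 := phase_le m β (t - j)
      have h4 := start_of_phase_ne_zero hp
      rw [Nat.sub_sub] at h4
      exact ⟨j + phase m β (t - j), by rw [Finset.mem_Icc]; omega, by omega, h4⟩
  · exact absurd rfl h

lemma unsettled_congr {β' : ℕ → Bool} (h : ∀ s < t, β s = β' s) :
    unsettled m β t = unsettled m β' t := by
  have : ∀ j, phase m β (t - j) = phase m β' (t - j) := fun j =>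
    phase_congr fun s hs => h s (by omega)
  unfold unsettled
  simp only [this]

/-- The number of successful coins in the `q`-th window of length `2 m` after time `t`. -/
noncomputable def windowHits (m t : ℕ) (β : ℕ → Bool) (q : ℕ) : ℝ :=
  ∑ j ∈ Finset.range (2 * m), if β (t + 2 * m * q + j) then 1 else 0

lemma windowHits_nonneg (m t : ℕ) (β : ℕ → Bool) (q : ℕ) : 0 ≤ windowHits m t β q :=
  Finset.sum_nonneg fun _ _ => by split_ifs <;> simp

/-- The coin responsible for an unsettled step right after a window falls into this window. -/
lemma one_le_windowHits (hm : 1 ≤ m) {q : ℕ} (h : unsettled m β (t + 2 * m * (q + 1)) ≠ 0) :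
    1 ≤ windowHits m t β q := by
  rw [mul_add, mul_one] at h
  rcases exists_start_of_unsettled hm h with h | ⟨j, hj, -, -, hb⟩
  · omega
  · rw [Finset.mem_Icc] at hj
    have h1 := Finset.single_le_sum (f := fun j => if β (t + 2 * m * q + j) then (1 : ℝ) else 0)
      (fun _ _ => by split_ifs <;> simp) (Finset.mem_range.2 (by omega : 2 * m - j < 2 * m))
    rw [show t + (2 * m * q + 2 * m) - j = t + 2 * m * q + (2 * m - j) by omega] at hb
    simp only [hb, if_true] at h1
    exact h1

/-- A run surviving n further steps forces a successful coin in each of ⌊n/(2m)⌋ disjoint windows.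
Counting hits instead of taking indicators makes the union bound in `coinExp_windowHits_le` linear.
-/
lemma prod_unsettled_le (hm : 1 ≤ m) (β : ℕ → Bool) (t n : ℕ) :
    ((∏ i ∈ Finset.range (n + 1), unsettled m β (t + i) : ℕ) : ℝ) ≤
      unsettled m β t * ∏ q ∈ Finset.range (n / (2 * m)), windowHits m t β q := by
  by_cases h : ∃ i ∈ Finset.range (n + 1), unsettled m β (t + i) = 0
  · rw [Finset.prod_eq_zero_iff.2 h, Nat.cast_zero]
    exact mul_nonneg (Nat.cast_nonneg _) (Finset.prod_nonneg fun q _ => windowHits_nonneg m t β q)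
  · push Not at h
    have h1 : ∀ i < n + 1, unsettled m β (t + i) = 1 := fun i hi => by
      have := unsettled_le_one m β (t + i)
      have := h i (Finset.mem_range.2 hi)
      omega
    rw [Finset.prod_eq_one fun i hi => h1 i (Finset.mem_range.1 hi),
      show unsettled m β t = 1 from h1 0 (by omega), Nat.cast_one, one_mul]
    refine Finset.prod_induction _ (fun x : ℝ => 1 ≤ x) (fun a b ha hb => by nlinarith) le_rfl
      fun q hq => one_le_windowHits hm ?_
    rw [Finset.mem_range] at hq
    refine h _ (Finset.mem_range.2 ?_)
    have := Nat.mul_le_of_le_div (2 * m) (q + 1) n hq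
    rw [mul_comm] at this
    omega

variable {ℓ : ℕ}

lemma dependsOnPast_windowHits (m t k : ℕ) :
    DependsOnPast (t + 2 * m * k) fun β (_ : ℕ → Fin ℓ) =>
      ∏ q ∈ Finset.range k, windowHits m t β q := by
  intro β β' e e' hβ _
  refine Finset.prod_congr rfl fun q hq => Finset.sum_congr rfl fun j hj => ?_
  rw [Finset.mem_range] at hq hj
  have : 2 * m * (q + 1) ≤ 2 * m * k := Nat.mul_le_mul_left _ hq
  rw [mul_add] at this
  rw [hβ _ (by omega)]

variable [NeZero ℓ] {T N : ℕ} {ε : ℝ} {Ψ : (ℕ → Bool) → (ℕ → Fin ℓ) → ℝ}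

/-- The windows are disjoint and lie after the past seen by `Ψ`, so they can be integrated out from
the last one backwards, each contributing a factor 2mε. -/
lemma coinExp_windowHits_le (h0 : 0 ≤ ε) (h1 : ε ≤ 1) (ht : 1 ≤ t) (hΨ : DependsOnPast t Ψ)
    (hΨ0 : ∀ β e, 0 ≤ Ψ β e) (k : ℕ) :
    coinExp T N ε (fun β e => Ψ β e * ∏ q ∈ Finset.range k, windowHits m t β q) ≤
      (2 * m * ε) ^ k * coinExp T N ε Ψ := by
  induction k with
  | zero => simp
  | succ k ih =>
    have hdep : DependsOnPast (t + 2 * m * k) fun β e =>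
        Ψ β e * ∏ q ∈ Finset.range k, windowHits m t β q :=
      (hΨ.mono (by omega)).mul (dependsOnPast_windowHits m t k)
    calc _ = ∑ j ∈ Finset.range (2 * m), coinExp T N ε fun β e =>
          (if β (t + 2 * m * k + j) then 1 else 0) *
            (Ψ β e * ∏ q ∈ Finset.range k, windowHits m t β q) := by
          rw [← coinExp_sum]
          refine coinExp_congr fun β e _ => ?_
          rw [Finset.prod_range_succ, ← Finset.sum_mul]
          change _ = windowHits m t β k * _
          ring
      _ ≤ ∑ _j ∈ Finset.range (2 * m), ε * coinExp T N ε fun β e =>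
            Ψ β e * ∏ q ∈ Finset.range k, windowHits m t β q := by
          refine Finset.sum_le_sum fun j _ => ?_
          exact coinExp_coin_le h0 h1 (by omega) (hdep.mono (by omega)) fun β e =>
            mul_nonneg (hΨ0 β e) (Finset.prod_nonneg fun q _ => windowHits_nonneg m t β q)
      _ = (2 * m * ε) * coinExp T N ε fun β e =>
            Ψ β e * ∏ q ∈ Finset.range k, windowHits m t β q := by
          simp; ring
      _ ≤ (2 * m * ε) * ((2 * m * ε) ^ k * coinExp T N ε Ψ) := by gcongr
      _ = _ := by ring

/-- Runs of unsettled steps have expected length `O(m)`, whatever happened before. -/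
lemma coinExp_unsettledRun_le (hm : 1 ≤ m) (h0 : 0 ≤ ε) (h1 : ε ≤ 1) (hε : 2 * m * ε ≤ 3 / 4)
    (ht : 1 ≤ t) (hΨ : DependsOnPast t Ψ) (hΨ0 : ∀ β e, 0 ≤ Ψ β e) :
    coinExp T N ε (fun β e => unsettledRun m β T t * Ψ β e) ≤
      8 * m * coinExp T N ε fun β e => unsettled m β t * Ψ β e := by
  have hdep : DependsOnPast t fun β e => (unsettled m β t : ℝ) * Ψ β e := by
    refine DependsOnPast.mul (fun β β' e e' hβ _ => ?_) hΨ
    simp only [unsettled_congr hβ]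
  have hnn : ∀ β e, 0 ≤ (unsettled m β t : ℝ) * Ψ β e := fun β e =>
    mul_nonneg (Nat.cast_nonneg _) (hΨ0 β e)
  have hE := coinExp_nonneg (T := T) (N := N) h0 h1 fun β e _ => hnn β e
  calc _ ≤ coinExp T N ε fun β e => ∑ n ∈ Finset.range (T + 1 - t),
        (unsettled m β t * Ψ β e) * ∏ q ∈ Finset.range (n / (2 * m)), windowHits m t β q := by
        refine coinExp_mono h0 h1 fun β e _ => ?_
        rw [unsettledRun, Nat.cast_sum, Finset.sum_mul]
        refine Finset.sum_le_sum fun n _ => ?_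
        have := mul_le_mul_of_nonneg_right (prod_unsettled_le hm β t n) (hΨ0 β e)
        linarith
    _ ≤ ∑ n ∈ Finset.range (T + 1 - t), (2 * m * ε) ^ (n / (2 * m)) *
        coinExp T N ε fun β e => unsettled m β t * Ψ β e := by
        rw [coinExp_sum]
        exact Finset.sum_le_sum fun n _ => coinExp_windowHits_le h0 h1 ht hdep hnn _
    _ ≤ 8 * m * coinExp T N ε fun β e => unsettled m β t * Ψ β e := by
        rw [← Finset.sum_mul]
        refine mul_le_mul_of_nonneg_right ?_ hE
        -- With ratio 2mε ≤ 3/4 the series is at most 2m / (1 - 3/4) = 8m.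
        refine (sum_pow_div_le (by positivity) (by linarith) (by omega) _).trans ?_
        rw [div_le_iff₀ (by linarith)]
        push_cast
        have : (0 : ℝ) ≤ m := Nat.cast_nonneg m
        nlinarith

end Runs

/-! ### The learning dynamics -/

section Dynamics

variable {M : Type*} [MetricSpace M] {ℓ : ℕ}

lemma Instance.weights_congr (P : Instance M ℓ) {m : ℕ} {η α : ℝ} {β β' : ℕ → Bool}
    {e e' : ℕ → Fin ℓ} {t : ℕ} (hβ : ∀ s < t, β s = β' s) (he : ∀ s < t, e s = e' s) :
    P.weights m η α β e t = P.weights m η α β' e' t := by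
  induction t with
  | zero => rfl
  | succ t ih =>
    have h1 : P.loss e t = P.loss e' t := by
      funext i; simp only [Instance.loss, he t (by omega)]
    rw [Instance.weights, Instance.weights, phase_congr fun s hs => hβ s (by omega),
      ih (fun s hs => hβ s (by omega)) fun s hs => he s (by omega), h1]

/-- The average cost at time `t` under the distribution of the learner at time `s`. -/
noncomputable def Instance.meanCost (P : Instance M ℓ) (m : ℕ) (η α : ℝ) (s t : ℕ)
    (β : ℕ → Bool) (e : ℕ → Fin ℓ) : ℝ :=
  ∑ i, P.x m η α β e s i * (P.f i t).toReal

/-- The loss of the learner if `t` is an exploration step. -/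
noncomputable def Instance.learnerLoss (P : Instance M ℓ) (m : ℕ) (η α : ℝ) (t : ℕ)
    (β : ℕ → Bool) (e : ℕ → Fin ℓ) : ℝ :=
  ∑ i, P.x m η α β e t i * P.loss e t i

/-- Indicator of an exploitation step. -/
noncomputable def exploits (m s : ℕ) (β : ℕ → Bool) : ℝ := if phase m β s = 0 then 1 else 0

/-- Indicator of an exploitation step with a successful coin. -/
noncomputable def starts (m s : ℕ) (β : ℕ → Bool) : ℝ :=
  if phase m β s = 0 ∧ β s = true then 1 else 0

/-- Indicator of an exploration step. -/
noncomputable def explores (m s : ℕ) (β : ℕ → Bool) : ℝ := if phase m β s = m then 1 else 0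

lemma exploits_nonneg (m s : ℕ) (β : ℕ → Bool) : 0 ≤ exploits m s β := by
  unfold exploits; split_ifs <;> simp

lemma starts_nonneg (m s : ℕ) (β : ℕ → Bool) : 0 ≤ starts m s β := by
  unfold starts; split_ifs <;> simp

lemma explores_nonneg (m s : ℕ) (β : ℕ → Bool) : 0 ≤ explores m s β := by
  unfold explores; split_ifs <;> simp

lemma starts_eq_mul (m s : ℕ) (β : ℕ → Bool) :
    starts m s β = (if β s then 1 else 0) * exploits m s β := by
  unfold starts exploits
  by_cases h1 : phase m β s = 0 <;> by_cases h2 : β s = true <;> simp [h1, h2]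

lemma explores_add {m : ℕ} (hm : 1 ≤ m) (s : ℕ) (β : ℕ → Bool) :
    explores m (s + m) β = starts m s β := by
  unfold explores starts
  simp only [phase_add_delay_iff hm]

/-- An exploration step at time m would need a successful coin at time 0. -/
lemma explores_eq_zero {m t : ℕ} (hm : 1 ≤ m) (ht : t ≤ m) {β : ℕ → Bool} (hβ : β 0 = false) :
    explores m t β = 0 := by
  refine if_neg fun h => ?_
  have h1 := phase_le m β t
  obtain rfl : t = 0 + m := by omega
  have := ((phase_add_delay_iff hm).1 h).2
  simp [hβ] at this

lemma starts_zero {m : ℕ} {β : ℕ → Bool} (hβ : β 0 = false) : starts m 0 β = 0 := by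
  simp [starts, hβ]

lemma dependsOnPast_exploits (m s : ℕ) :
    DependsOnPast s fun β (_ : ℕ → Fin ℓ) => exploits m s β := by
  intro β β' e e' hβ _
  simp only [exploits, phase_congr hβ]

lemma Instance.dependsOnPast_x (P : Instance M ℓ) (m : ℕ) (η α : ℝ) (s : ℕ) (i : Fin ℓ) :
    DependsOnPast s fun β e => P.x m η α β e s i := by
  intro β β' e e' hβ he
  simp only [Instance.x, P.weights_congr hβ he]

lemma Instance.dependsOnPast_meanCost (P : Instance M ℓ) (m : ℕ) (η α : ℝ) (s t : ℕ) :
    DependsOnPast s fun β e => P.meanCost m η α s t β e := by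
  intro β β' e e' hβ he
  simp only [Instance.meanCost, Instance.x, P.weights_congr hβ he]

lemma Instance.x_eq_normalized (P : Instance M ℓ) (m : ℕ) (η α : ℝ) (β : ℕ → Bool)
    (e : ℕ → Fin ℓ) (t : ℕ) : P.x m η α β e t = normalized (P.weights m η α β e t) := rfl

lemma Instance.weights_add {P : Instance M ℓ} {m : ℕ} {η α : ℝ} {β : ℕ → Bool} {e : ℕ → Fin ℓ}
    {s : ℕ} (hs : phase m β s = 0) {j : ℕ} (hj : j ≤ m) :
    P.weights m η α β e (s + j) = P.weights m η α β e s := by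
  induction j with
  | zero => rfl
  | succ j ih =>
    rw [← add_assoc, Instance.weights, if_neg (phase_add_ne_delay hs (by omega)), ih (by omega)]

/-- The assumptions on the instance and on the parameters used in the analysis. -/
structure Instance.Admissible (P : Instance M ℓ) (m : ℕ) (ε η α γ D : ℝ) : Prop where
  two_le : 2 ≤ m
  diam_eq : D = diameter M
  diam_pos : 0 < D
  cost_le : ∀ i, ∀ t ∈ Finset.Icc 1 P.T, P.f i t ≤ ENNReal.ofReal (2 * D)
  η_nonneg : 0 ≤ η
  α_pos : 0 < α
  α_le : α ≤ 1 / 2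
  γ_eq : γ = 1 - Real.exp (-η)
  γ_le : γ ≤ 3 / 4
  ε_pos : 0 < ε
  ε_le : ε ≤ 1
  mε_le : 2 * m * ε ≤ 3 / 4

namespace Instance.Admissible

variable {P : Instance M ℓ} {m : ℕ} {ε η α γ D : ℝ} {β : ℕ → Bool}
  {e : ℕ → Fin ℓ} {s t : ℕ}

lemma one_le (h : P.Admissible m ε η α γ D) : 1 ≤ m := one_le_two.trans h.two_le

lemma cost_toReal_le (h : P.Admissible m ε η α γ D) (ht : t ∈ Finset.Icc 1 P.T) (i : Fin ℓ) :
    (P.f i t).toReal ≤ 2 * D :=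
  ENNReal.toReal_le_of_le_ofReal (by linarith [h.diam_pos]) (h.cost_le i t ht)

lemma cost_ne_top (h : P.Admissible m ε η α γ D) (ht : t ∈ Finset.Icc 1 P.T) (i : Fin ℓ) :
    P.f i t ≠ ∞ := ne_top_of_le_ne_top ENNReal.ofReal_ne_top (h.cost_le i t ht)

lemma loss_nonneg (h : P.Admissible m ε η α γ D) (e : ℕ → Fin ℓ) (t : ℕ) (i : Fin ℓ) :
    0 ≤ P.loss e t i := by
  have := h.diam_pos
  rw [Instance.loss, ← h.diam_eq]
  split_ifs <;> positivity

lemma loss_le_one (h : P.Admissible m ε η α γ D) (e : ℕ → Fin ℓ) (ht : t ∈ Finset.Icc 1 P.T)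
    (i : Fin ℓ) : P.loss e t i ≤ 1 := by
  have := h.diam_pos
  rw [Instance.loss, ← h.diam_eq]
  split_ifs
  · exact (div_le_one (by positivity)).2 (h.cost_toReal_le ht i)
  · exact zero_le_one

lemma weights_pos (h : P.Admissible m ε η α γ D) (β : ℕ → Bool) (e : ℕ → Fin ℓ) (t : ℕ)
    (i : Fin ℓ) : 0 < P.weights m η α β e t i := by
  induction t generalizing i with
  | zero => exact one_pos
  | succ t ih =>
    rw [Instance.weights]
    split_ifs
    · exact shareUpdate_pos h.η_nonneg h.α_pos.le ih (h.loss_nonneg e t) i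
    · exact ih i

lemma learnerLoss_eq (h : P.Admissible m ε η α γ D) (t : ℕ) (β : ℕ → Bool) (e : ℕ → Fin ℓ) :
    P.learnerLoss m η α t β e =
      P.x m η α β e t (e t) * ((P.f (e t) t).toReal / (2 * D)) := by
  simp [Instance.learnerLoss, Instance.loss, h.diam_eq]

lemma meanCost_add (hs : phase m β s = 0) {j : ℕ} (hj : j ≤ m) (t : ℕ) :
    P.meanCost m η α (s + j) t β e = P.meanCost m η α s t β e := by
  simp only [Instance.meanCost, Instance.x, Instance.weights_add hs hj]

/-- For an exploitation step s, the distribution at any time up to s + m is already determined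
before time s. It is therefore independent of the coin at s and of the index explored at s + m. -/
lemma exploits_mul_meanCost_add (s : ℕ) {j : ℕ} (hj : j ≤ m) (t : ℕ) (β : ℕ → Bool)
    (e : ℕ → Fin ℓ) :
    exploits m s β * P.meanCost m η α (s + j) t β e =
      exploits m s β * P.meanCost m η α s t β e := by
  by_cases hs : phase m β s = 0
  · rw [meanCost_add hs hj]
  · simp [exploits, hs]

/-- Bernoulli's inequality together with mε ≤ 3/8. -/
lemma half_le_pow (h : P.Admissible m ε η α γ D) {j : ℕ} (hj : j ≤ m) :
    1 / 2 ≤ (1 - ε) ^ j := by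
  have h1 := one_add_mul_le_pow (a := -ε) (by linarith [h.ε_le]) j
  have h2 : (j : ℝ) ≤ m := Nat.cast_le.2 hj
  have h3 := mul_le_mul_of_nonneg_right h2 h.ε_pos.le
  have h4 := h.mε_le
  rw [← sub_eq_add_neg] at h1
  linarith

variable [NeZero ℓ]

lemma x_pos (h : P.Admissible m ε η α γ D) (β : ℕ → Bool) (e : ℕ → Fin ℓ) (t : ℕ) (i : Fin ℓ) :
    0 < P.x m η α β e t i := normalized_pos (h.weights_pos β e t) i

lemma x_mem (h : P.Admissible m ε η α γ D) (β : ℕ → Bool) (e : ℕ → Fin ℓ) (t : ℕ) :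
    P.x m η α β e t ∈ stdSimplex ℝ (Fin ℓ) := normalized_mem (h.weights_pos β e t)

lemma meanCost_nonneg (h : P.Admissible m ε η α γ D) (s t : ℕ) (β : ℕ → Bool) (e : ℕ → Fin ℓ) :
    0 ≤ P.meanCost m η α s t β e :=
  Finset.sum_nonneg fun i _ => mul_nonneg (h.x_pos β e s i).le ENNReal.toReal_nonneg

lemma meanCost_le (h : P.Admissible m ε η α γ D) (ht : t ∈ Finset.Icc 1 P.T) :
    P.meanCost m η α s t β e ≤ 2 * D := by
  calc _ ≤ ∑ i, P.x m η α β e s i * (2 * D) := Finset.sum_le_sum fun i _ =>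
        mul_le_mul_of_nonneg_left (h.cost_toReal_le ht i) (h.x_pos β e s i).le
    _ = _ := by rw [← Finset.sum_mul, (h.x_mem β e s).2, one_mul]

lemma learnerLoss_nonneg (h : P.Admissible m ε η α γ D) (t : ℕ) (β : ℕ → Bool) (e : ℕ → Fin ℓ) :
    0 ≤ P.learnerLoss m η α t β e :=
  Finset.sum_nonneg fun i _ => mul_nonneg (h.x_pos β e t i).le (h.loss_nonneg e t i)

/-- The effect of a complete exploration block on the average cost. -/
lemma meanCost_after_block (h : P.Admissible m ε η α γ D) {j : ℕ} (hj : j + 1 ≤ m)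
    (ht : s + m + (j + 1) ∈ Finset.Icc 1 P.T) :
    starts m s β * P.meanCost m η α (s + m + (j + 1)) (s + m + (j + 1)) β e ≤
      4 * (starts m s β * P.meanCost m η α s (s + m + (j + 1)) β e) +
      8 * α * η * D * (explores m (s + m) β * P.learnerLoss m η α (s + m) β e) := by
  rw [explores_add h.one_le]
  by_cases hs : phase m β s = 0 ∧ β s = true
  · have hend := phase_add_of_start hs.1 hs.2 h.one_le le_rfl
    have hnext := phase_block_end h.one_le hend
    rw [show starts m s β = 1 from if_pos hs, one_mul, one_mul, one_mul,
      show s + m + (j + 1) = s + m + 1 + j by omega, meanCost_add hnext (by omega)]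
    have hlt : s + m ∈ Finset.Icc 1 P.T := by
      rw [Finset.mem_Icc] at ht ⊢
      have := h.two_le
      omega
    have hw : P.weights m η α β e (s + m + 1) =
        shareUpdate η α (P.weights m η α β e s) (P.loss e (s + m)) := by
      rw [Instance.weights, if_pos hend, Instance.weights_add hs.1 le_rfl]
    -- The costs are bounded by 2D rather than D, whence the coefficient 4 · 2 = 8 of the loss term.
    have key := average_update_le h.γ_eq h.γ_le h.η_nonneg h.α_pos.le (h.weights_pos β e s)
      (h.loss_nonneg e (s + m)) (h.loss_le_one e hlt)
      (f := fun i => (P.f i (s + m + 1 + j)).toReal) (fun i => ENNReal.toReal_nonneg)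
      (h.cost_toReal_le (by rwa [show s + m + 1 + j = s + m + (j + 1) by omega]))
    rw [← hw] at key
    have hx : P.x m η α β e (s + m) = P.x m η α β e s := by
      simp only [Instance.x_eq_normalized, Instance.weights_add hs.1 le_rfl]
    simp only [Instance.meanCost, Instance.learnerLoss, hx]
    simp only [Instance.x_eq_normalized]
    linarith
  · simp [starts, hs]

/-- The expected average cost at time `t`. -/
noncomputable def _root_.MTS.Instance.expMean (P : Instance M ℓ) (m : ℕ) (ε η α : ℝ) (t : ℕ) : ℝ :=
  coinExp P.T (P.T + m) ε (P.meanCost m η α t t)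

/-- The part of the expected average cost at time `t` which the learner may observe. -/
noncomputable def _root_.MTS.Instance.expObservable (P : Instance M ℓ) (m : ℕ) (ε η α : ℝ) (t : ℕ) :
    ℝ :=
  coinExp P.T (P.T + m) ε fun β e => exploits m (t - m) β * P.meanCost m η α t t β e

/-- The expected loss of the learner at time `t`. -/
noncomputable def _root_.MTS.Instance.expLoss (P : Instance M ℓ) (m : ℕ) (ε η α : ℝ) (t : ℕ) : ℝ :=
  coinExp P.T (P.T + m) ε fun β e => explores m t β * P.learnerLoss m η α t β e

lemma expMean_nonneg (h : P.Admissible m ε η α γ D) (t : ℕ) : 0 ≤ P.expMean m ε η α t :=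
  coinExp_nonneg h.ε_pos.le h.ε_le fun β e _ => h.meanCost_nonneg t t β e

lemma expMean_le (h : P.Admissible m ε η α γ D) (ht : t ∈ Finset.Icc 1 P.T) :
    P.expMean m ε η α t ≤ 2 * D :=
  (coinExp_mono h.ε_pos.le h.ε_le fun _ _ _ => h.meanCost_le ht).trans_eq (coinExp_const _)

lemma expObservable_nonneg (h : P.Admissible m ε η α γ D) (t : ℕ) :
    0 ≤ P.expObservable m ε η α t :=
  coinExp_nonneg h.ε_pos.le h.ε_le fun β e _ =>
    mul_nonneg (exploits_nonneg _ _ _) (h.meanCost_nonneg t t β e)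

lemma expObservable_le (h : P.Admissible m ε η α γ D) (t : ℕ) :
    P.expObservable m ε η α t ≤ P.expMean m ε η α t := by
  refine coinExp_mono h.ε_pos.le h.ε_le fun β e _ =>
    mul_le_of_le_one_left (h.meanCost_nonneg t t β e) ?_
  unfold exploits
  split_ifs <;> simp

lemma expLoss_nonneg (h : P.Admissible m ε η α γ D) (t : ℕ) : 0 ≤ P.expLoss m ε η α t :=
  coinExp_nonneg h.ε_pos.le h.ε_le fun β e _ =>
    mul_nonneg (explores_nonneg _ _ _) (h.learnerLoss_nonneg t β e)

lemma expLoss_eq_zero (h : P.Admissible m ε η α γ D) (ht : t ≤ m) : P.expLoss m ε η α t = 0 :=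
  (coinExp_congr fun β e hβ => by rw [explores_eq_zero h.one_le ht hβ, zero_mul]).trans
    (coinExp_const 0)

lemma coinExp_starts_le (h : P.Admissible m ε η α γ D) (hs : 1 ≤ s) (t : ℕ) :
    coinExp P.T (P.T + m) ε (fun β e => starts m s β * P.meanCost m η α s t β e) ≤
      ε * coinExp P.T (P.T + m) ε fun β e => exploits m s β * P.meanCost m η α s t β e := by
  simp only [starts_eq_mul, mul_assoc]
  exact coinExp_coin_le h.ε_pos.le h.ε_le hs
    ((dependsOnPast_exploits m s).mul (P.dependsOnPast_meanCost m η α s t))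
    fun β e => mul_nonneg (exploits_nonneg _ _ _) (h.meanCost_nonneg s t β e)

lemma coinExp_starts_near (h : P.Admissible m ε η α γ D) (hs : 1 ≤ s) {j : ℕ} (hj : j ≤ m) :
    coinExp P.T (P.T + m) ε
      (fun β e => starts m s β * P.meanCost m η α (s + j) (s + j) β e) ≤
      ε * P.expMean m ε η α (s + j) := by
  have h1 : coinExp P.T (P.T + m) ε
      (fun β e => starts m s β * P.meanCost m η α (s + j) (s + j) β e) =
      coinExp P.T (P.T + m) ε (fun β e => starts m s β * P.meanCost m η α s (s + j) β e) :=
    coinExp_congr fun β e _ => by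
      rw [starts_eq_mul, mul_assoc, exploits_mul_meanCost_add s hj, mul_assoc]
  rw [h1]
  refine (h.coinExp_starts_le hs _).trans (mul_le_mul_of_nonneg_left ?_ h.ε_pos.le)
  refine coinExp_mono h.ε_pos.le h.ε_le fun β e _ => ?_
  rw [← exploits_mul_meanCost_add s hj]
  refine mul_le_of_le_one_left (h.meanCost_nonneg _ _ β e) ?_
  unfold exploits
  split_ifs <;> simp

/-- If the coin at s fails, which has probability 1 - ε independently of the past, then s + 1 is
again an exploitation step with the same distribution. -/
lemma coinExp_exploits_succ (h : P.Admissible m ε η α γ D) (hs : 1 ≤ s) (hsT : s ≤ P.T) (t : ℕ) :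
    (1 - ε) * coinExp P.T (P.T + m) ε
        (fun β e => exploits m s β * P.meanCost m η α s t β e) ≤
      coinExp P.T (P.T + m) ε
        fun β e => exploits m (s + 1) β * P.meanCost m η α (s + 1) t β e := by
  have h1 := coinExp_coin (N := P.T + m) (ε := ε) hs hsT
    ((dependsOnPast_exploits m s).mul (P.dependsOnPast_meanCost m η α s t))
    fun c => if c then 0 else 1
  simp only [if_true, Bool.false_eq_true, if_false, mul_zero, mul_one, zero_add] at h1
  rw [← h1]
  refine coinExp_mono h.ε_pos.le h.ε_le fun β e _ => ?_
  by_cases h2 : phase m β s = 0 ∧ β s = false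
  · have h3 : phase m β (s + 1) = 0 :=
      phase_eq_zero_of_no_start (j := 1) h2.1 fun i hi => by
        obtain rfl : i = 0 := by omega
        simpa using h2.2
    rw [meanCost_add h2.1 h.one_le, exploits, exploits, h2.1, h2.2, h3]
    simp
  · have h3 : (if β s = true then (0 : ℝ) else 1) * (exploits m s β * P.meanCost m η α s t β e)
        = 0 := by
      unfold exploits
      by_cases h4 : phase m β s = 0 <;> by_cases h5 : β s = true <;> simp_all
    rw [h3]
    exact mul_nonneg (exploits_nonneg _ _ _) (h.meanCost_nonneg _ _ β e)

lemma coinExp_exploits_add (h : P.Admissible m ε η α γ D) (hs : 1 ≤ s) {j : ℕ}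
    (hsT : s + j ≤ P.T + 1) (t : ℕ) :
    (1 - ε) ^ j * coinExp P.T (P.T + m) ε
        (fun β e => exploits m s β * P.meanCost m η α s t β e) ≤
      coinExp P.T (P.T + m) ε
        fun β e => exploits m (s + j) β * P.meanCost m η α (s + j) t β e := by
  induction j with
  | zero => simp
  | succ j ih =>
    refine le_trans ?_ (h.coinExp_exploits_succ (s := s + j) (by omega) (by omega) t)
    rw [pow_succ', mul_assoc]
    exact mul_le_mul_of_nonneg_left (ih (by omega)) (sub_nonneg.2 h.ε_le)

/-- Here the block has already changed the weights, so the distribution at time t = s + m + j + 1 is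
first traced back to time s by `meanCost_after_block`. The coin at s then gives ε. With probability
at least 1/2 no block starts in the j + 1 steps from s on; on that event t - m is an exploitation
step and the distribution is unchanged at t, so what remains is at most twice the observable cost.
-/
lemma coinExp_starts_far (h : P.Admissible m ε η α γ D) (hs : 1 ≤ s) {j : ℕ} (hj : j + 1 ≤ m)
    (ht : s + m + (j + 1) ≤ P.T) :
    coinExp P.T (P.T + m) ε (fun β e => starts m s β *
      P.meanCost m η α (s + m + (j + 1)) (s + m + (j + 1)) β e) ≤
      8 * ε * P.expObservable m ε η α (s + m + (j + 1)) +
      8 * α * η * D * P.expLoss m ε η α (s + m) := by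
  have h1 : P.expObservable m ε η α (s + m + (j + 1)) = coinExp P.T (P.T + m) ε fun β e =>
      exploits m (s + (j + 1)) β * P.meanCost m η α (s + (j + 1)) (s + m + (j + 1)) β e := by
    refine coinExp_congr fun β e _ => ?_
    rw [show s + m + (j + 1) - m = s + (j + 1) by omega,
      ← exploits_mul_meanCost_add (s + (j + 1)) (le_refl m),
      show s + (j + 1) + m = s + m + (j + 1) by omega]
  have h2 := h.coinExp_exploits_add hs (j := j + 1) (by omega) (s + m + (j + 1))
  rw [← h1] at h2
  have h3 := h.coinExp_starts_le hs (s + m + (j + 1))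
  have h4 := h.half_le_pow hj
  have h5 : 0 ≤ coinExp P.T (P.T + m) ε fun β e =>
      exploits m s β * P.meanCost m η α s (s + m + (j + 1)) β e :=
    coinExp_nonneg h.ε_pos.le h.ε_le fun β e _ =>
      mul_nonneg (exploits_nonneg _ _ _) (h.meanCost_nonneg _ _ β e)
  have h6 := mul_le_mul_of_nonneg_right h4 h5
  have h7 : coinExp P.T (P.T + m) ε (fun β e => exploits m s β *
      P.meanCost m η α s (s + m + (j + 1)) β e) ≤
      2 * P.expObservable m ε η α (s + m + (j + 1)) := by linarith
  have h8 := mul_le_mul_of_nonneg_left h7 h.ε_pos.le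
  refine (coinExp_mono h.ε_pos.le h.ε_le fun β e _ =>
    h.meanCost_after_block hj (Finset.mem_Icc.2 ⟨by omega, ht⟩)).trans ?_
  rw [coinExp_add, coinExp_mul_left, coinExp_mul_left]
  change _ + 8 * α * η * D * P.expLoss m ε η α (s + m) ≤ _
  linarith

/-- The same bound for truncated starting times. -/
lemma coinExp_starts_sub_far (h : P.Admissible m ε η α γ D) (ht : t ∈ Finset.Icc 1 P.T) {j : ℕ}
    (hj : j + 1 ≤ m) :
    coinExp P.T (P.T + m) ε (fun β e => starts m (t - (m + (j + 1))) β *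
      P.meanCost m η α t t β e) ≤
      8 * ε * P.expObservable m ε η α t + 8 * α * η * D * P.expLoss m ε η α (t - (j + 1)) := by
  rw [Finset.mem_Icc] at ht
  by_cases h1 : m + (j + 1) < t
  · obtain ⟨s, hs, rfl⟩ : ∃ s, 1 ≤ s ∧ t = s + m + (j + 1) :=
      ⟨t - (m + (j + 1)), by omega, by omega⟩
    rw [show s + m + (j + 1) - (m + (j + 1)) = s by omega, Nat.add_sub_cancel]
    exact h.coinExp_starts_far hs hj ht.2
  -- Truncated subtraction points at time 0, where no block can start.
  · rw [show t - (m + (j + 1)) = 0 by omega,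
      (coinExp_congr fun β e hβ => by rw [starts_zero hβ, zero_mul]).trans (coinExp_const 0)]
    have h2 := h.expObservable_nonneg t
    have h3 := h.expLoss_nonneg (t - (j + 1))
    have := h.ε_pos
    have := h.α_pos
    have := h.η_nonneg
    have := h.diam_pos
    positivity

lemma coinExp_starts_sub_near (h : P.Admissible m ε η α γ D) (ht : 1 ≤ t) {j : ℕ}
    (hj : j ≤ m) :
    coinExp P.T (P.T + m) ε (fun β e => starts m (t - j) β * P.meanCost m η α t t β e) ≤
      ε * P.expMean m ε η α t := by
  by_cases h1 : j < t
  · obtain ⟨s, hs, rfl⟩ : ∃ s, 1 ≤ s ∧ t = s + j := ⟨t - j, by omega, by omega⟩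
    rw [Nat.add_sub_cancel]
    exact h.coinExp_starts_near hs hj
  · rw [show t - j = 0 by omega,
      (coinExp_congr fun β e hβ => by rw [starts_zero hβ, zero_mul]).trans (coinExp_const 0)]
    exact mul_nonneg h.ε_pos.le (h.expMean_nonneg t)

/-- A random quantity of the block starting at `s`, evaluated at the explored heuristic. -/
lemma coinExp_starts_explored (h : P.Admissible m ε η α γ D) (hs : 1 ≤ s) (hsT : s + m ≤ P.T)
    {φ : (ℕ → Bool) → (ℕ → Fin ℓ) → Fin ℓ → ℝ} (hφ : ∀ i, DependsOnPast s fun β e => φ β e i) :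
    coinExp P.T (P.T + m) ε (fun β e => starts m s β * φ β e (e (s + m))) =
      ε / ℓ * coinExp P.T (P.T + m) ε fun β e => exploits m s β * ∑ i, φ β e i := by
  have hm := h.two_le
  rw [coinExp_explored (s := s + m) (Ψ := fun β e i => starts m s β * φ β e i) (by omega)
    (by omega) fun β e e' i he => congrArg _
      (hφ i β β e e' (fun _ _ => rfl) fun t ht => he t (by omega))]
  simp only [starts_eq_mul, mul_assoc]
  rw [Finset.sum_congr rfl fun i _ => coinExp_coin hs (by omega)
    ((dependsOnPast_exploits m s).mul (hφ i)) fun c => if c then 1 else 0,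
    ← Finset.mul_sum, ← coinExp_sum]
  simp only [Finset.mul_sum, if_true, Bool.false_eq_true, if_false, mul_zero, mul_one, add_zero]
  ring

/-- Exploration at t means that t - m is an exploitation step with a successful coin. That coin
contributes ε, the uniform explored index 1/ℓ, and the normalization of the losses 1/(2D), all
independent of the frozen distribution. -/
lemma expLoss_eq (h : P.Admissible m ε η α γ D) (ht : m < t) (htT : t ≤ P.T) :
    P.expLoss m ε η α t = ε / (2 * D * ℓ) * P.expObservable m ε η α t := by
  obtain ⟨s, hs, rfl⟩ : ∃ s, 1 ≤ s ∧ t = s + m := ⟨t - m, by omega, by omega⟩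
  have hφ : ∀ i, DependsOnPast s fun β e =>
      P.x m η α β e s i * ((P.f i (s + m)).toReal / (2 * D)) := fun i =>
    (P.dependsOnPast_x m η α s i).mul fun _ _ _ _ _ _ => rfl
  have h1 : P.expLoss m ε η α (s + m) = coinExp P.T (P.T + m) ε fun β e =>
      starts m s β * (P.x m η α β e s (e (s + m)) *
        ((P.f (e (s + m)) (s + m)).toReal / (2 * D))) := by
    refine coinExp_congr fun β e _ => ?_
    rw [explores_add h.one_le, h.learnerLoss_eq]
    by_cases h2 : phase m β s = 0
    · rw [Instance.x_eq_normalized, Instance.weights_add h2 le_rfl, Instance.x_eq_normalized]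
    · simp [starts, h2]
  rw [h1, h.coinExp_starts_explored hs htT hφ, Instance.expObservable, Nat.add_sub_cancel]
  rw [show ε / (2 * D * ℓ) = ε / ℓ * (1 / (2 * D)) by ring, mul_assoc]
  rw [← coinExp_mul_left (1 / (2 * D))]
  congr 1
  refine coinExp_congr fun β e _ => ?_
  rw [exploits_mul_meanCost_add s (le_refl m), Instance.meanCost]
  simp only [Finset.mul_sum]
  exact Finset.sum_congr rfl fun i _ => by ring

lemma coinExp_comparator_le (h : P.Admissible m ε η α γ D) (ht : t ∈ Finset.Icc 1 P.T)
    (i : Fin ℓ) :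
    coinExp P.T (P.T + m) ε (fun β e => explores m t β * P.loss e t i) ≤
      ε / (2 * D * ℓ) * (P.f i t).toReal := by
  rw [Finset.mem_Icc] at ht
  have hD := h.diam_pos
  have hε := h.ε_pos
  by_cases htm : t ≤ m
  · rw [(coinExp_congr fun β e hβ => by rw [explores_eq_zero h.one_le htm hβ, zero_mul]).trans
      (coinExp_const 0)]
    positivity
  · obtain ⟨s, hs, rfl⟩ : ∃ s, 1 ≤ s ∧ t = s + m := ⟨t - m, by omega, by omega⟩
    have h1 := h.coinExp_starts_explored hs ht.2
      (φ := fun β e j => if i = j then (P.f i (s + m)).toReal / (2 * D) else 0)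
      fun i _ _ _ _ _ _ => rfl
    have h2 : ∀ β (e : ℕ → Fin ℓ), explores m (s + m) β * P.loss e (s + m) i = starts m s β *
        (if i = e (s + m) then (P.f i (s + m)).toReal / (2 * D) else 0) := fun β e => by
      rw [explores_add h.one_le, Instance.loss, h.diam_eq]
    simp only [h2, h1, Finset.sum_ite_eq, Finset.mem_univ, if_true]
    have h3 : coinExp P.T (P.T + m) ε
        (fun β (_ : ℕ → Fin ℓ) => exploits m s β * ((P.f i (s + m)).toReal / (2 * D))) ≤
        (P.f i (s + m)).toReal / (2 * D) := by
      refine (coinExp_mono h.ε_pos.le h.ε_le fun β e _ => ?_).trans_eq (coinExp_const _)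
      refine mul_le_of_le_one_left (by positivity) ?_
      unfold exploits
      split_ifs <;> simp
    calc _ ≤ ε / ℓ * ((P.f i (s + m)).toReal / (2 * D)) := by gcongr
      _ = _ := by field_simp

/-- A step that is not an exploitation step lies in a block which started at most m steps earlier.
-/
lemma one_sub_exploits_le (hm : 1 ≤ m) {t : ℕ} (β : ℕ → Bool) :
    1 ≤ exploits m t β + ∑ j ∈ Finset.range m, starts m (t - (j + 1)) β := by
  have hnn : 0 ≤ ∑ j ∈ Finset.range m, starts m (t - (j + 1)) β :=
    Finset.sum_nonneg fun j _ => starts_nonneg _ _ _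
  by_cases h0 : phase m β t = 0
  · rw [exploits, if_pos h0]; linarith
  · have h1 := phase_le_delay hm β t
    have h2 := start_of_phase_ne_zero h0
    have h3 := Finset.single_le_sum (f := fun j => starts m (t - (j + 1)) β)
      (fun j _ => starts_nonneg m (t - (j + 1)) β)
      (Finset.mem_range.2 (by omega : phase m β t - 1 < m))
    have h4 : starts m (t - (phase m β t - 1 + 1)) β = 1 :=
      if_pos (by rwa [show phase m β t - 1 + 1 = phase m β t by omega])
    simp only [h4] at h3
    linarith [exploits_nonneg m t β]

/-- Most of the expected cost is observable. -/
lemma expMean_le_observable (h : P.Admissible m ε η α γ D) (ht : t ∈ Finset.Icc 1 P.T) :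
    P.expMean m ε η α t ≤ (1 + 8 * m * ε) * P.expObservable m ε η α t +
      8 * α * η * D * ∑ j ∈ Finset.range m, P.expLoss m ε η α (t - (j + 1)) := by
  calc P.expMean m ε η α t ≤ coinExp P.T (P.T + m) ε fun β e =>
        exploits m (t - m) β * P.meanCost m η α t t β e +
        ∑ j ∈ Finset.range m, starts m (t - (m + (j + 1))) β * P.meanCost m η α t t β e := by
        refine coinExp_mono h.ε_pos.le h.ε_le fun β e _ => ?_
        have h1 := mul_le_mul_of_nonneg_right (one_sub_exploits_le h.one_le (t := t - m) β)
          (h.meanCost_nonneg t t β e)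
        simp only [Nat.sub_sub] at h1
        rwa [one_mul, add_mul, Finset.sum_mul] at h1
    _ ≤ P.expObservable m ε η α t + ∑ j ∈ Finset.range m, (8 * ε * P.expObservable m ε η α t +
          8 * α * η * D * P.expLoss m ε η α (t - (j + 1))) := by
        rw [coinExp_add, coinExp_sum]
        refine add_le_add le_rfl (Finset.sum_le_sum fun j hj => ?_)
        exact h.coinExp_starts_sub_far ht (Finset.mem_range.1 hj)
    _ = _ := by
        simp only [Finset.sum_add_distrib, Finset.sum_const, Finset.card_range, nsmul_eq_mul,
          ← Finset.mul_sum]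
        ring

/-- The expected cost incurred in unsettled steps. -/
lemma coinExp_unsettled_le (h : P.Admissible m ε η α γ D) (ht : t ∈ Finset.Icc 1 P.T) :
    coinExp P.T (P.T + m) ε (fun β e => unsettled m β t * P.meanCost m η α t t β e) ≤
      (if t < m then 2 * D else 0) + 9 * m * ε * P.expMean m ε η α t +
      8 * α * η * D * ∑ j ∈ Finset.range m, P.expLoss m ε η α (t - (j + 1)) := by
  have ht1 := (Finset.mem_Icc.1 ht).1
  calc _ ≤ coinExp P.T (P.T + m) ε fun β e => (if t < m then 2 * D else 0) +
        -- A block starting up to m steps before t has not changed the distribution at t (near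
        -- case); one starting m + 1 to 2m steps before t may have done so (far case).
        ∑ j ∈ Finset.range (m + m), starts m (t - (j + 1)) β * P.meanCost m η α t t β e := by
        refine coinExp_mono h.ε_pos.le h.ε_le fun β e _ => ?_
        have hx := h.meanCost_nonneg t t β e
        have hD := h.diam_pos
        have hnn : ∀ j ∈ Finset.range (m + m),
            0 ≤ starts m (t - (j + 1)) β * P.meanCost m η α t t β e := fun j _ =>
          mul_nonneg (starts_nonneg _ _ _) hx
        have hnn' := Finset.sum_nonneg hnn
        by_cases hu : unsettled m β t = 0
        · rw [hu, Nat.cast_zero, zero_mul]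
          split_ifs <;> linarith
        · have hu1 : unsettled m β t = 1 := by
            have := unsettled_le_one m β t; omega
          rw [hu1, Nat.cast_one, one_mul]
          rcases exists_start_of_unsettled h.one_le hu with h1 | ⟨j, hj, -, h1⟩
          · rw [if_pos (by omega)]
            have := h.meanCost_le (s := t) (β := β) (e := e) ht
            linarith
          · rw [Finset.mem_Icc] at hj
            have h2 := Finset.single_le_sum hnn (Finset.mem_range.2 (by omega : j - 1 < m + m))
            rw [show j - 1 + 1 = j by omega, show starts m (t - j) β = 1 from if_pos h1,
              one_mul] at h2
            split_ifs <;> linarith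
    _ ≤ (if t < m then 2 * D else 0) + (∑ _j ∈ Finset.range m, ε * P.expMean m ε η α t +
        ∑ j ∈ Finset.range m, (8 * ε * P.expMean m ε η α t +
          8 * α * η * D * P.expLoss m ε η α (t - (j + 1)))) := by
        rw [coinExp_add, coinExp_const, coinExp_sum, Finset.sum_range_add]
        refine add_le_add le_rfl (add_le_add (Finset.sum_le_sum fun j hj => ?_)
          (Finset.sum_le_sum fun j hj => ?_))
        · rw [Finset.mem_range] at hj
          exact h.coinExp_starts_sub_near ht1 (by omega)
        · refine (h.coinExp_starts_sub_far ht (Finset.mem_range.1 hj)).trans ?_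
          have := mul_le_mul_of_nonneg_left (h.expObservable_le t) h.ε_pos.le
          linarith
    _ = _ := by
        simp only [Finset.sum_add_distrib, Finset.sum_const, Finset.card_range, nsmul_eq_mul,
          ← Finset.mul_sum]
        ring

end Instance.Admissible

end Dynamics

/-! ### The expected cost of the algorithm -/

section Cost

variable {M : Type*} [MetricSpace M] {ℓ : ℕ}

namespace Instance.Admissible

variable {P : Instance M ℓ} {m : ℕ} {ε η α γ D : ℝ} {β : ℕ → Bool}
  {e : ℕ → Fin ℓ} {t : ℕ}

/-- The cost of the exploited heuristics including switches, each step being weighted with the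
length of the unsettled run which it starts. -/
noncomputable def _root_.MTS.Instance.weightedCost (P : Instance M ℓ) (m : ℕ) (D : ℝ)
    (β : ℕ → Bool) (r : ℕ → Fin ℓ) : ℝ :=
  ∑ t ∈ Finset.Icc 1 P.T, (1 + 2 * (unsettledRun m β P.T t : ℝ)) *
    ((P.f (r t) t).toReal + D * if r (t - 1) = r t then 0 else 1)

lemma weightedCost_nonneg (h : P.Admissible m ε η α γ D) (β : ℕ → Bool) (r : ℕ → Fin ℓ) :
    0 ≤ P.weightedCost m D β r := by
  have := h.diam_pos
  exact Finset.sum_nonneg fun t _ => by positivity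

lemma pathCost_le_weightedCost [BoundedSpace M] (h : P.Admissible m ε η α γ D)
    {greedy : ℕ → M → M} (hg : P.IsGreedy greedy) {r : ℕ → Fin ℓ}
    (hr : ∀ t, t + 1 ≤ P.T → phase m β t ≠ m → r (t + 1) = r t) :
    P.pathCost (P.algState m greedy β e r) ≤ ENNReal.ofReal (P.weightedCost m D β r) := by
  have hD := h.diam_pos
  refine (P.pathCost_algState_le hg h.two_le hr).trans ?_
  rw [Instance.weightedCost, ENNReal.ofReal_sum_of_nonneg fun t _ => by positivity]
  refine Finset.sum_le_sum fun t ht => ?_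
  rw [ENNReal.ofReal_mul (by positivity), ENNReal.ofReal_add zero_le_one (by positivity),
    ENNReal.ofReal_one, ENNReal.ofReal_mul zero_le_two, ENNReal.ofReal_natCast,
    ENNReal.ofReal_ofNat, ENNReal.ofReal_add ENNReal.toReal_nonneg (by positivity),
    ENNReal.ofReal_toReal (h.cost_ne_top ht _)]
  refine mul_le_mul_right ((P.exploited_cost_le r t).trans_eq ?_) _
  rw [h.diam_eq]
  split_ifs <;> simp

/-- A bound on the expected cost at time `t` given the coins and the explored heuristics. -/
noncomputable def _root_.MTS.Instance.stepCost (P : Instance M ℓ) (m : ℕ) (η α D : ℝ) (t : ℕ)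
    (β : ℕ → Bool) (e : ℕ → Fin ℓ) : ℝ :=
  P.meanCost m η α t t β e +
    D * η * (explores m (t - 1) β * P.learnerLoss m η α (t - 1) β e)

lemma dependsOnPast_stepCost (P : Instance M ℓ) (m : ℕ) (η α D : ℝ) (ht : 1 ≤ t) :
    DependsOnPast t (P.stepCost m η α D t) := by
  refine (P.dependsOnPast_meanCost m η α t t).add fun β β' e e' hβ he => ?_
  obtain ⟨u, rfl⟩ : ∃ u, t = u + 1 := ⟨t - 1, by omega⟩
  have h1 : P.loss e u = P.loss e' u := by
    funext i; simp only [Instance.loss, he u (by omega)]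
  have h2 : phase m β u = phase m β' u := phase_congr fun s hs => hβ s (by omega)
  have h3 : P.weights m η α β e u = P.weights m η α β' e' u :=
    P.weights_congr (fun s hs => hβ s (by omega)) fun s hs => he s (by omega)
  simp only [Nat.add_sub_cancel, explores, Instance.learnerLoss, Instance.x, h1, h2, h3]

variable [NeZero ℓ]

/-- SHARE competes in expectation with every sequence of heuristics with few switches. -/
lemma sum_expLoss_le (h : P.Admissible m ε η α γ D) (i : ℕ → Fin ℓ) {k : ℕ}
    (hk : ((Finset.Icc 2 P.T).filter fun t => i (t - 1) ≠ i t).card ≤ k) :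
    (1 - α) * γ * ∑ t ∈ Finset.Icc 1 P.T, P.expLoss m ε η α t ≤
      η * (ε / (2 * D * ℓ) * ∑ t ∈ Finset.Icc 1 P.T, (P.f (i t) t).toReal) +
        (k + 1) * Real.log (2 * ℓ / α) := by
  have hpath : ∀ β e, (1 - α) * γ * ∑ t ∈ Finset.Icc 1 P.T,
      explores m t β * P.learnerLoss m η α t β e ≤
      η * ∑ t ∈ Finset.Icc 1 P.T, explores m t β * P.loss e t (i t) +
        (k + 1) * Real.log (2 * ℓ / α) := by
    intro β e
    have hg0 : ∀ t j, 0 ≤ explores m t β * P.loss e t j := fun t j =>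
      mul_nonneg (explores_nonneg _ _ _) (h.loss_nonneg e t j)
    -- With zero loss outside exploration steps, every step is a SHARE update and `share_regret`
    -- applies on the full time axis.
    have hu : ∀ t, P.weights m η α β e (t + 1) = shareUpdate η α (P.weights m η α β e t)
        fun j => explores m t β * P.loss e t j := by
      intro t
      rw [Instance.weights]
      unfold explores
      split_ifs
      · simp only [one_mul]
      · simp only [zero_mul, shareUpdate_zero]
    have h1 : P.weights m η α β e 1 = fun _ => 1 := by
      rw [Instance.weights, if_neg (by have := h.two_le; simp only [phase]; omega),
        Instance.weights]
    refine le_of_eq_of_le ?_ (share_regret (w := P.weights m η α β e)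
      (g := fun t j => explores m t β * P.loss e t j) h.γ_eq h.η_nonneg h.α_pos
      (by linarith [h.α_le]) hu (h.weights_pos β e) h1 hg0 (fun t ht j => ?_) i hk)
    · congr 1
      refine Finset.sum_congr rfl fun t _ => ?_
      rw [Instance.learnerLoss, Finset.mul_sum]
      refine Finset.sum_congr rfl fun j _ => ?_
      rw [Instance.x_eq_normalized]
      ring
    · have := h.loss_le_one e ht j
      have h0 := h.loss_nonneg e t j
      unfold explores
      split_ifs <;> linarith
  have h2 := coinExp_mono (T := P.T) (N := P.T + m) h.ε_pos.le h.ε_le fun β e _ => hpath β e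
  rw [coinExp_mul_left, coinExp_sum, coinExp_add, coinExp_mul_left, coinExp_sum,
    coinExp_const] at h2
  refine h2.trans ?_
  gcongr
  · exact h.η_nonneg
  · rw [Finset.mul_sum]
    exact Finset.sum_le_sum fun t ht => h.coinExp_comparator_le ht (i t)

lemma movement_x_le (h : P.Admissible m ε η α γ D) (t : ℕ) (β : ℕ → Bool) (e : ℕ → Fin ℓ) :
    ∑ i, max 0 (P.x m η α β e t i - P.x m η α β e (t + 1) i) ≤
      η * (explores m t β * P.learnerLoss m η α t β e) := by
  unfold explores
  by_cases h1 : phase m β t = m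
  · have h2 := movement_le h.η_nonneg h.α_pos.le (by linarith [h.α_le]) (h.weights_pos β e t)
      (h.loss_nonneg e t)
    rw [if_pos h1, one_mul]
    simp only [Instance.x_eq_normalized, Instance.learnerLoss]
    rwa [Instance.weights, if_pos h1]
  · have h2 : P.x m η α β e (t + 1) = P.x m η α β e t := by
      simp only [Instance.x_eq_normalized, Instance.weights, if_neg h1]
    simp [h1, h2]

lemma stepCost_nonneg (h : P.Admissible m ε η α γ D) (t : ℕ) (β : ℕ → Bool) (e : ℕ → Fin ℓ) :
    0 ≤ P.stepCost m η α D t β e :=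
  add_nonneg (h.meanCost_nonneg t t β e) (mul_nonneg (mul_nonneg h.diam_pos.le h.η_nonneg)
    (mul_nonneg (explores_nonneg _ _ _) (h.learnerLoss_nonneg _ β e)))

/-- Given coins and explored indices, the run lengths are constants and the exploited index has law
x_t. Only its marginals and one-step transitions enter the cost. -/
lemma chainExp_weightedCost_le (h : P.Admissible m ε η α γ D)
    {τ : (Fin ℓ → ℝ) → (Fin ℓ → ℝ) → Fin ℓ → Fin ℓ → ℝ} (hτ : IsOptimalPlan τ) (β : ℕ → Bool)
    (e : ℕ → Fin ℓ) :
    chainExp (fun _ => 1 / (ℓ : ℝ))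
      (fun t => roundProb τ (P.x m η α β e (t - 1)) (P.x m η α β e t)) P.T
      (P.weightedCost m D β) ≤
      ∑ t ∈ Finset.Icc 1 P.T, (1 + 2 * (unsettledRun m β P.T t : ℝ)) *
        P.stepCost m η α D t β e := by
  set x := P.x m η α β e with hx
  have hpos := h.x_pos β e
  have hmem := h.x_mem β e
  have h0 : (fun _ => 1 / (ℓ : ℝ)) = x 0 := by
    funext i; simp [hx, Instance.x, Instance.weights]
  have hmarg : ∀ t < P.T, ∀ j,
      ∑ i, x t i * roundProb τ (x (t + 1 - 1)) (x (t + 1)) i j = x (t + 1) j := fun t _ j =>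
    sum_mul_roundProb hτ (hmem t) (hmem (t + 1)) (hpos t) j
  have hrow : ∀ t < P.T, ∀ i, ∑ j, roundProb τ (x (t + 1 - 1)) (x (t + 1)) i j = 1 :=
    fun t _ i => sum_roundProb hτ (hmem t) (hmem (t + 1)) (hpos t i)
  unfold Instance.weightedCost
  rw [chainExp_sum]
  refine Finset.sum_le_sum fun t ht => ?_
  rw [Finset.mem_Icc] at ht
  rw [chainExp_mul_left, chainExp_add, chainExp_mul_left]
  refine mul_le_mul_of_nonneg_left ?_ (by positivity)
  obtain ⟨u, rfl⟩ : ∃ u, t = u + 1 := ⟨t - 1, by omega⟩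
  rw [chainExp_state h0 hmarg hrow ht.2 fun i => (P.f i (u + 1)).toReal, Nat.add_sub_cancel,
    chainExp_transition h0 hmarg hrow ht.2 fun i j => if i = j then 0 else 1]
  refine add_le_add le_rfl ?_
  rw [Nat.add_sub_cancel, sum_roundProb_switch hτ (hmem u) (hmem (u + 1)) (hpos u), mul_assoc]
  exact mul_le_mul_of_nonneg_left (h.movement_x_le u β e) h.diam_pos.le

lemma expectedCost_le [BoundedSpace M] (h : P.Admissible m ε η α γ D)
    {τ : (Fin ℓ → ℝ) → (Fin ℓ → ℝ) → Fin ℓ → Fin ℓ → ℝ} (hτ : IsOptimalPlan τ)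
    {greedy : ℕ → M → M} (hg : P.IsGreedy greedy) :
    P.expectedCost m ε η α τ greedy ≤ ENNReal.ofReal (∑ t ∈ Finset.Icc 1 P.T,
      coinExp P.T (P.T + m) ε fun β e => (1 + 2 * (unsettledRun m β P.T t : ℝ)) *
        P.stepCost m η α D t β e) := by
  have hε := h.ε_pos
  have hε1 := h.ε_le
  have hround : ∀ (ω : Outcome P.T m ℓ) (t : ℕ),
      0 ≤ roundProb τ (P.x m η α ω.β ω.e (t - 1)) (P.x m η α ω.β ω.e t) (ω.i (t - 1)) (ω.i t) :=
    fun ω t => roundProb_nonneg hτ (h.x_mem _ _ _) (h.x_mem _ _ _) _ _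
  have hprob : ∀ ω, 0 ≤ P.prob m ε η α τ ω := by
    intro ω
    refine mul_nonneg (mul_nonneg (Finset.prod_nonneg fun t _ => ?_) (by positivity))
      (mul_nonneg (by positivity) (Finset.prod_nonneg fun t _ => hround ω t))
    split_ifs <;> linarith
  have hpoint : ∀ ω : Outcome P.T m ℓ, ENNReal.ofReal (P.prob m ε η α τ ω) *
      P.pathCost (P.algState m greedy ω.β ω.e ω.i) ≤
      ENNReal.ofReal (P.prob m ε η α τ ω * P.weightedCost m D ω.β ω.i) := by
    intro ω
    -- The pathwise bound needs an exploited index that is kept except after exploration steps;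
    -- outcomes violating this have probability zero.
    by_cases h0 : P.prob m ε η α τ ω = 0
    · simp [h0]
    · rw [ENNReal.ofReal_mul (hprob ω)]
      refine mul_le_mul_right (h.pathCost_le_weightedCost hg fun t ht hp => ?_) _
      have h1 := Finset.prod_ne_zero_iff.1 (right_ne_zero_of_mul (right_ne_zero_of_mul h0))
        (t + 1) (Finset.mem_Icc.2 ⟨by omega, ht⟩)
      have h2 : P.x m η α ω.β ω.e (t + 1) = P.x m η α ω.β ω.e t := by
        simp only [Instance.x_eq_normalized, Instance.weights, if_neg hp]
      rw [Nat.add_sub_cancel, h2, roundProb_self] at h1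
      by_contra h3
      exact h1 (if_neg h3)
  refine (Finset.sum_le_sum fun ω _ => hpoint ω).trans ?_
  rw [← ENNReal.ofReal_sum_of_nonneg fun ω _ =>
    mul_nonneg (hprob ω) (h.weightedCost_nonneg _ _)]
  refine ENNReal.ofReal_le_ofReal ?_
  rw [← coinExp_sum]
  refine le_of_eq_of_le ?_ (coinExp_mono hε.le hε1 fun β e _ => h.chainExp_weightedCost_le hτ β e)
  have hcoins : ∀ b : Fin P.T → Bool,
      ∏ t ∈ Finset.Icc 1 P.T, (if extendCoins b t then ε else 1 - ε) =
        ∏ i, if b i then ε else 1 - ε := by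
    intro b
    rw [← Finset.Ico_add_one_right_eq_Icc, Finset.prod_Ico_eq_prod_range, Nat.add_sub_cancel,
      Finset.prod_range]
    refine Finset.prod_congr rfl fun i _ => ?_
    have hi : 1 ≤ 1 + (i : ℕ) ∧ 1 + (i : ℕ) ≤ P.T := ⟨by omega, by omega⟩
    simp only [extendCoins, dif_pos hi, Nat.add_sub_cancel_left, Fin.eta]
  unfold coinExp chainExp
  rw [Fintype.sum_prod_type]
  refine Finset.sum_congr rfl fun b _ => ?_
  rw [Fintype.sum_prod_type, Finset.mul_sum]
  refine Finset.sum_congr rfl fun v _ => ?_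
  rw [← mul_assoc, Finset.mul_sum]
  refine Finset.sum_congr rfl fun r _ => ?_
  rw [← hcoins b]
  have hconst : ∏ _i : Fin (P.T + m), 1 / (ℓ : ℝ) =
      ∏ _t ∈ Finset.Icc 1 (P.T + m), 1 / (ℓ : ℝ) := by simp
  rw [hconst, ← mul_assoc]
  rfl

/-- The term 2U costs a factor 2 · 8m on unsettled steps only; with `coinExp_unsettled_le` this
yields 16m · 9mε = 144m²ε and 16m · 8 = 128m. -/
lemma coinExp_step_le (h : P.Admissible m ε η α γ D) (ht : t ∈ Finset.Icc 1 P.T) :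
    (coinExp P.T (P.T + m) ε fun β e => (1 + 2 * (unsettledRun m β P.T t : ℝ)) *
        P.stepCost m η α D t β e) ≤
      (1 + 144 * m ^ 2 * ε) * P.expMean m ε η α t +
      (1 + 16 * m) * (D * η * P.expLoss m ε η α (t - 1)) +
      16 * m * (if t < m then 2 * D else 0) +
      128 * m * α * η * D * ∑ j ∈ Finset.range m, P.expLoss m ε η α (t - (j + 1)) := by
  have ht1 := (Finset.mem_Icc.1 ht).1
  have hrun := coinExp_unsettledRun_le (T := P.T) (N := P.T + m) h.one_le h.ε_pos.le h.ε_le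
    h.mε_le ht1 (dependsOnPast_stepCost P m η α D ht1) (h.stepCost_nonneg t)
  have hDη := mul_nonneg h.diam_pos.le h.η_nonneg
  have hstep : coinExp P.T (P.T + m) ε (P.stepCost m η α D t) =
      P.expMean m ε η α t + D * η * P.expLoss m ε η α (t - 1) := by
    unfold Instance.stepCost
    rw [coinExp_add, coinExp_mul_left]
    rfl
  have hun : coinExp P.T (P.T + m) ε (fun β e => unsettled m β t * P.stepCost m η α D t β e) ≤
      coinExp P.T (P.T + m) ε (fun β e => unsettled m β t * P.meanCost m η α t t β e) +
        D * η * P.expLoss m ε η α (t - 1) := by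
    rw [Instance.expLoss, ← coinExp_mul_left, ← coinExp_add]
    refine coinExp_mono h.ε_pos.le h.ε_le fun β e _ => ?_
    rw [Instance.stepCost, mul_add]
    refine add_le_add le_rfl (mul_le_of_le_one_left (mul_nonneg hDη
      (mul_nonneg (explores_nonneg _ _ _) (h.learnerLoss_nonneg _ β e))) ?_)
    exact_mod_cast unsettled_le_one m β t
  have h1 := h.coinExp_unsettled_le ht
  have h2 : (coinExp P.T (P.T + m) ε fun β e => (1 + 2 * (unsettledRun m β P.T t : ℝ)) *
      P.stepCost m η α D t β e) = coinExp P.T (P.T + m) ε (P.stepCost m η α D t) +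
      2 * coinExp P.T (P.T + m) ε
        (fun β e => unsettledRun m β P.T t * P.stepCost m η α D t β e) := by
    rw [← coinExp_mul_left, ← coinExp_add]
    exact coinExp_congr fun β e _ => by ring
  rw [h2, hstep]
  have h3 := mul_le_mul_of_nonneg_left (hun.trans (add_le_add h1 le_rfl))
    (by positivity : (0 : ℝ) ≤ 8 * m)
  have h4 := hrun.trans h3
  linarith

end Instance.Admissible

end Cost

/-! ### Summing up -/

lemma sum_Icc_sub_le {F : ℕ → ℝ} (hF : ∀ t, 0 ≤ F t) (h0 : F 0 = 0) (T i : ℕ) :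
    ∑ t ∈ Finset.Icc 1 T, F (t - i) ≤ ∑ t ∈ Finset.Icc 1 T, F t := by
  induction i generalizing F with
  | zero => simp
  | succ i ih =>
    have h1 : ∀ T, ∑ t ∈ Finset.Icc 1 T, F (t - 1) + F T = ∑ t ∈ Finset.Icc 1 T, F t := by
      intro T
      induction T with
      | zero => simp [h0]
      | succ T ih =>
        rw [Finset.sum_Icc_succ_top (by omega), Finset.sum_Icc_succ_top (by omega),
          Nat.add_sub_cancel, ih]
    have h2 := ih (F := fun t => F (t - 1)) (fun t => hF _) h0
    simp only [Nat.sub_sub] at h2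
    linarith [h1 T, hF T]

lemma sum_Icc_ite_le {c : ℝ} (hc : 0 ≤ c) (T n : ℕ) :
    ∑ t ∈ Finset.Icc 1 T, (if t ≤ n then c else 0) ≤ n * c := by
  rw [← Finset.sum_filter, Finset.sum_const, nsmul_eq_mul]
  gcongr
  calc _ ≤ (Finset.Icc 1 n).card := Finset.card_le_card fun t ht => by
        simp only [Finset.mem_filter, Finset.mem_Icc] at ht ⊢; omega
    _ = n := by simp

section Total

variable {M : Type*} [MetricSpace M] {ℓ : ℕ} [NeZero ℓ]

namespace Instance.Admissible

variable {P : Instance M ℓ} {m : ℕ} {ε η α γ D : ℝ}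

lemma sum_expLoss_sub_le (h : P.Admissible m ε η α γ D) (i : ℕ) :
    ∑ t ∈ Finset.Icc 1 P.T, P.expLoss m ε η α (t - i) ≤
      ∑ t ∈ Finset.Icc 1 P.T, P.expLoss m ε η α t :=
  sum_Icc_sub_le h.expLoss_nonneg (h.expLoss_eq_zero (Nat.zero_le _)) _ _

lemma sum_sum_expLoss_le (h : P.Admissible m ε η α γ D) :
    ∑ t ∈ Finset.Icc 1 P.T, ∑ j ∈ Finset.range m, P.expLoss m ε η α (t - (j + 1)) ≤
      m * ∑ t ∈ Finset.Icc 1 P.T, P.expLoss m ε η α t := by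
  rw [Finset.sum_comm]
  refine (Finset.sum_le_sum fun j _ => h.sum_expLoss_sub_le (j + 1)).trans_eq ?_
  simp

/-- The expected cost in terms of the observable cost `A` and the loss `Λ` of the learner. -/
lemma total_le (h : P.Admissible m ε η α γ D) :
    ∃ A : ℝ, 0 ≤ A ∧
      2 * D * ℓ * ∑ t ∈ Finset.Icc 1 P.T, P.expLoss m ε η α t = ε * A ∧
      ∃ B : ℝ, B ≤ 2 * D * m + (1 + 8 * m * ε) * A +
        8 * α * η * D * (m * ∑ t ∈ Finset.Icc 1 P.T, P.expLoss m ε η α t) ∧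
      ∑ t ∈ Finset.Icc 1 P.T, (coinExp P.T (P.T + m) ε fun β e =>
        (1 + 2 * (unsettledRun m β P.T t : ℝ)) * P.stepCost m η α D t β e) ≤
      (1 + 144 * m ^ 2 * ε) * B +
      (1 + 16 * m) * (D * η * ∑ t ∈ Finset.Icc 1 P.T, P.expLoss m ε η α t) +
      16 * m * (m * (2 * D)) +
      128 * m * α * η * D * (m * ∑ t ∈ Finset.Icc 1 P.T, P.expLoss m ε η α t) := by
  have hD := h.diam_pos
  have hε := h.ε_pos
  have hα := h.α_pos
  have hη := h.η_nonneg
  have hℓ : (ℓ : ℝ) ≠ 0 := NeZero.ne _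
  set Λ := ∑ t ∈ Finset.Icc 1 P.T, P.expLoss m ε η α t with hΛ
  -- For t ≤ m the truncated t - m is 0, an exploitation step, yet nothing is learned. These steps
  -- are left out of A and paid by 2D each.
  refine ⟨∑ t ∈ Finset.Icc 1 P.T, if t ≤ m then 0 else P.expObservable m ε η α t,
    Finset.sum_nonneg fun t _ => ?_, ?_, ∑ t ∈ Finset.Icc 1 P.T, P.expMean m ε η α t, ?_, ?_⟩
  · split_ifs
    exacts [le_rfl, h.expObservable_nonneg t]
  · rw [hΛ, Finset.mul_sum, Finset.mul_sum]
    refine Finset.sum_congr rfl fun t ht => ?_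
    split_ifs with htm
    · rw [h.expLoss_eq_zero htm, mul_zero, mul_zero]
    · rw [h.expLoss_eq (by omega) (Finset.mem_Icc.1 ht).2]
      field_simp
  · have h1 : ∀ t ∈ Finset.Icc 1 P.T, P.expMean m ε η α t ≤ (if t ≤ m then 2 * D else 0) +
        (1 + 8 * m * ε) * (if t ≤ m then 0 else P.expObservable m ε η α t) +
        8 * α * η * D * ∑ j ∈ Finset.range m, P.expLoss m ε η α (t - (j + 1)) := by
      intro t ht
      have h2 : 0 ≤ ∑ j ∈ Finset.range m, P.expLoss m ε η α (t - (j + 1)) :=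
        Finset.sum_nonneg fun j _ => h.expLoss_nonneg _
      split_ifs
      · have := h.expMean_le ht
        have : 0 ≤ 8 * α * η * D * ∑ j ∈ Finset.range m, P.expLoss m ε η α (t - (j + 1)) := by
          positivity
        linarith
      · rw [zero_add]
        exact h.expMean_le_observable ht
    refine (Finset.sum_le_sum h1).trans ?_
    rw [Finset.sum_add_distrib, Finset.sum_add_distrib, ← Finset.mul_sum, ← Finset.mul_sum]
    have h2 := sum_Icc_ite_le (by positivity : 0 ≤ 2 * D) P.T m
    have h3 := mul_le_mul_of_nonneg_left h.sum_sum_expLoss_le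
      (by positivity : 0 ≤ 8 * α * η * D)
    linarith
  · refine (Finset.sum_le_sum fun t ht => h.coinExp_step_le ht).trans ?_
    simp only [Finset.sum_add_distrib, ← Finset.mul_sum]
    have h2 : ∑ t ∈ Finset.Icc 1 P.T, (if t < m then 2 * D else 0) ≤ m * (2 * D) := by
      refine (Finset.sum_le_sum fun t _ => ?_).trans
        (sum_Icc_ite_le (by positivity : 0 ≤ 2 * D) P.T m)
      split_ifs <;> first | omega | positivity | exact le_rfl
    gcongr
    · exact h.sum_expLoss_sub_le 1
    · exact h.sum_sum_expLoss_le

end Instance.Admissible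

end Total

/-! ### Real arithmetic behind the final bound -/

/-- The observable cost is close to the benchmark. -/
lemma observable_le_benchmark {ℓ k D V ε η α γ A Λ F lg lg2 : ℝ} (hℓ : 1 ≤ ℓ)
    (hk : 1 ≤ k) (hD : 0 < D) (hV : 0 < V) (hγ0 : 0 < γ) (hγ : γ ≤ 3 / 4) (hα : α = γ ^ 2)
    (hα1 : α ≤ 1 / 2) (hε0 : 0 < ε) (hη0 : 0 ≤ η)
    (hη : η * (1 - γ) ≤ γ) (hDk : D * ℓ * k = α * ε * V) (hAΛ : 2 * D * ℓ * Λ = ε * A)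
    (hreg : (1 - α) * γ * Λ ≤ η * (ε / (2 * D * ℓ) * F) + (k + 1) * lg2)
    (hF : F ≤ (1 + 2 * γ) * V) (hlg : 1 / 2 ≤ lg) (hlg2 : lg2 ≤ 2 * lg) :
    A ≤ V + 32 * (γ * V) + 16 * (γ * V * lg) := by
  have hα0 : 0 < α := by rw [hα]; positivity
  have hγV : 0 < γ * V := by positivity
  have hlog : (2 * D * ℓ) * ((k + 1) * lg2) ≤ 8 * (α * ε * V) * lg := by
    have h1 : (2 * D * ℓ) * ((k + 1) * lg2) ≤ (2 * D * ℓ) * ((2 * k) * (2 * lg)) := by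
      have : 0 ≤ 2 * D * ℓ := by positivity
      refine mul_le_mul_of_nonneg_left ?_ this
      calc (k + 1) * lg2 ≤ (k + 1) * (2 * lg) := by gcongr
        _ ≤ 2 * k * (2 * lg) := by
          refine mul_le_mul_of_nonneg_right ?_ ?_ <;> linarith
    rw [← hDk]
    linarith
  have hA1 : (1 - α) * γ * A ≤ η * F + 8 * (α * V) * lg := by
    have h1 := mul_le_mul_of_nonneg_left hreg (by positivity : 0 ≤ 2 * D * ℓ)
    have h2 : 2 * D * ℓ * ((1 - α) * γ * Λ) = ε * ((1 - α) * γ * A) := by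
      linear_combination ((1 - α) * γ) * hAΛ
    have h3 : 2 * D * ℓ * (η * (ε / (2 * D * ℓ) * F) + (k + 1) * lg2) =
        ε * (η * F) + 2 * D * ℓ * ((k + 1) * lg2) := by
      field_simp
    rw [h2, h3] at h1
    have h4 : ε * ((1 - α) * γ * A) ≤ ε * (η * F + 8 * (α * V) * lg) := by linarith
    exact le_of_mul_le_mul_left h4 hε0
  -- After rescaling by 2Dℓ/ε, the multiplicative regret of SHARE is η/((1 - α)γ), which is 1 + O(γ)
  -- since η ≤ γ/(1 - γ) and α = γ².
  have hpoly : η ≤ (1 + 12 * γ) * ((1 - α) * γ) := by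
    have h1 : 1 ≤ (1 + 4 * γ) * (1 - γ) := by nlinarith
    have h2 : η ≤ (1 + 4 * γ) * γ := by
      calc η = η * 1 := (mul_one η).symm
        _ ≤ η * ((1 + 4 * γ) * (1 - γ)) := by gcongr
        _ = (1 + 4 * γ) * (η * (1 - γ)) := by ring
        _ ≤ _ := by gcongr
    have h3 : 1 ≤ (1 + 2 * γ) * (1 - α) := by rw [hα] at hα1 ⊢; nlinarith
    have h4 : 0 ≤ (1 - α) * γ := mul_nonneg (by linarith) hγ0.le
    calc η ≤ (1 + 4 * γ) * γ * 1 := by linarith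
      _ ≤ (1 + 4 * γ) * γ * ((1 + 2 * γ) * (1 - α)) := by gcongr
      _ = (1 + 4 * γ) * (1 + 2 * γ) * ((1 - α) * γ) := by ring
      _ ≤ _ := by
        gcongr
        nlinarith
  have hA2 : A ≤ (1 + 12 * γ) * ((1 + 2 * γ) * V) + 16 * (γ * V * lg) := by
    have hpos : 0 < (1 - α) * γ := mul_pos (by linarith) hγ0
    refine le_of_mul_le_mul_left ?_ hpos
    calc (1 - α) * γ * A ≤ η * F + 8 * (α * V) * lg := hA1
      _ ≤ η * ((1 + 2 * γ) * V) + 8 * (α * V) * lg := by gcongr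
      _ ≤ (1 + 12 * γ) * ((1 - α) * γ) * ((1 + 2 * γ) * V) + 8 * (α * V) * lg := by gcongr
      _ ≤ (1 + 12 * γ) * ((1 - α) * γ) * ((1 + 2 * γ) * V) +
          (1 - α) * γ * (16 * (γ * V * lg)) := by
          have h5 : 0 ≤ α * V * lg := by positivity
          have h6 : (1 - α) * γ * (16 * (γ * V * lg)) = 16 * (1 - α) * (α * V * lg) := by
            rw [hα]; ring
          rw [h6]
          nlinarith
      _ = _ := by ring
  have h7 : γ * (γ * V) ≤ 3 / 4 * (γ * V) := by gcongr
  linarith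

/-- The lower order terms of the expected cost. -/
lemma total_le_observable {m ℓ k D V ε η α γ A B Λ S : ℝ} (hm : 2 ≤ m) (hℓ : 1 ≤ ℓ)
    (hk : 1 ≤ k) (hD : 0 < D) (hV : 0 < V) (hγ0 : 0 < γ) (hγ : γ ≤ 3 / 4) (hα0 : 0 < α)
    (hα1 : α ≤ 1 / 2) (hε : m ^ 2 * ε = γ) (hε0 : 0 < ε) (hη0 : 0 ≤ η)
    (hη : η * (1 - γ) ≤ γ) (hDk : D * ℓ * k = α * ε * V) (hA : 0 ≤ A) (hΛ : 0 ≤ Λ)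
    (hAΛ : 2 * D * ℓ * Λ = ε * A)
    (hB : B ≤ 2 * D * m + (1 + 8 * m * ε) * A + 8 * α * η * D * (m * Λ))
    (hS : S ≤ (1 + 144 * m ^ 2 * ε) * B + (1 + 16 * m) * (D * η * Λ) + 16 * m * (m * (2 * D)) +
      128 * m * α * η * D * (m * Λ)) :
    S ≤ 141 * (γ * V) + (1 + 1016 * γ) * A := by
  have hη3 : η ≤ 3 := by nlinarith
  have hmε0 : 0 < m * ε := mul_pos (by linarith) hε0
  have hmε : m * ε ≤ γ / 2 := by
    have : m * (m * ε) = γ := by rw [← hε]; ring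
    nlinarith
  have hε4 : ε ≤ γ / 4 := by nlinarith
  have hγV : 0 < γ * V := by positivity
  -- Multiplying Dℓk = αεV by m² gives Dm²ℓk = αγV; this absorbs the cost of the first m steps.
  have hDm : D * m ^ 2 ≤ γ * V := by
    have h1 : D * m ^ 2 * 1 ≤ D * m ^ 2 * (ℓ * k) := by
      have : 1 ≤ ℓ * k := one_le_mul_of_one_le_of_one_le hℓ hk
      gcongr
    have h2 : D * m ^ 2 * (ℓ * k) = α * (γ * V) := by
      rw [← hε]; linear_combination m ^ 2 * hDk
    have h3 : α * (γ * V) ≤ 1 * (γ * V) := by gcongr; linarith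
    linarith
  have hDm' : 2 * D * m ≤ D * m ^ 2 := by
    have : D * m * 2 ≤ D * m * m := by gcongr
    linarith
  have hDΛ0 : 0 ≤ D * Λ := by positivity
  have hDΛ : 2 * (D * Λ) ≤ ε * A := by
    rw [← hAΛ]
    have : 2 * (D * Λ) * 1 ≤ 2 * (D * Λ) * ℓ := by gcongr
    linarith
  have hηDΛ : D * η * Λ ≤ 3 / 2 * (ε * A) := by
    have : η * (D * Λ) ≤ 3 * (D * Λ) := by gcongr
    linarith
  have hDηΛ0 : 0 ≤ D * η * Λ := by positivity
  have hγA : 0 ≤ γ * A := by positivity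
  have hεA : ε * A ≤ γ / 4 * A := by gcongr
  have hmεA : m * ε * A ≤ γ / 2 * A := by gcongr
  have hmX : m * (D * η * Λ) ≤ 3 / 4 * (γ * A) := by
    have : m * (D * η * Λ) ≤ m * (3 / 2 * (ε * A)) := by gcongr
    linarith
  have hmX0 : 0 ≤ m * (D * η * Λ) := by positivity
  have e1 : 8 * α * η * D * (m * Λ) ≤ 3 * (γ * A) := by
    have : α * (m * (D * η * Λ)) ≤ 1 / 2 * (m * (D * η * Λ)) := by gcongr
    linarith
  have e2 : 128 * m * α * η * D * (m * Λ) ≤ 96 * (γ * A) := by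
    have h2 : m ^ 2 * (D * η * Λ) ≤ m ^ 2 * (3 / 2 * (ε * A)) := by gcongr
    have h5 : m ^ 2 * (3 / 2 * (ε * A)) = 3 / 2 * (γ * A) := by rw [← hε]; ring
    have h3 : α * (m ^ 2 * (D * η * Λ)) ≤ 1 / 2 * (m ^ 2 * (D * η * Λ)) := by gcongr
    linarith
  have e3 : (1 + 16 * m) * (D * η * Λ) ≤ 13 * (γ * A) := by
    linarith
  have hB2 : B ≤ γ * V + A + 7 * (γ * A) := by linarith
  have h1 : (1 + 144 * m ^ 2 * ε) * B ≤ (1 + 144 * γ) * (γ * V + A + 7 * (γ * A)) := by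
    rw [show 1 + 144 * m ^ 2 * ε = 1 + 144 * γ by rw [← hε]; ring]
    gcongr
  have h2 : γ * (γ * V) ≤ 3 / 4 * (γ * V) := by gcongr
  have h3 : γ * (γ * A) ≤ 3 / 4 * (γ * A) := by gcongr
  linarith

lemma final_arithmetic {V γ A lg S : ℝ} (hV : 0 < V) (hγ0 : 0 < γ) (hγ : γ ≤ 3 / 4)
    (hlg : 1 / 2 ≤ lg) (hA : A ≤ V + 32 * (γ * V) + 16 * (γ * V * lg))
    (hS : S ≤ 141 * (γ * V) + (1 + 1016 * γ) * A) : S ≤ V + 100000 * (γ * V * lg) := by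
  have hS4 : S ≤ 141 * (γ * V) + (1 + 1016 * γ) * (V + 32 * (γ * V) + 16 * (γ * V * lg)) := by
    refine hS.trans ?_
    gcongr
  have hγV : 0 < γ * V := by positivity
  have h0 : γ * V * (1 / 2) ≤ γ * V * lg := by gcongr
  have h1 : γ * (γ * V) ≤ 3 / 4 * (γ * V) := by gcongr
  have h2 : γ * (γ * V * lg) ≤ 3 / 4 * (γ * V * lg) := by gcongr
  linarith

/-! ### The benchmark -/

section Benchmark

variable {M : Type*} [MetricSpace M] {ℓ : ℕ}

lemma Instance.offlineOpt_le_pathCost (P : Instance M ℓ) (i : ℕ → Fin ℓ) :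
    P.offlineOpt ≤ P.pathCost fun t => P.state (i t) t :=
  iInf₂_le (fun t => P.state (i t) t) (P.state_zero (i 0))

lemma Instance.offlineOpt_le_optLE (P : Instance M ℓ) (k : ℕ) : P.offlineOpt ≤ P.optLE k :=
  le_iInf₂ fun i _ => P.offlineOpt_le_pathCost i

lemma Instance.optLE_le_sum (P : Instance M ℓ) (k : ℕ) (i : Fin ℓ) :
    P.optLE k ≤ ∑ t ∈ Finset.Icc 1 P.T, P.f i t :=
  iInf₂_le (fun _ => i) (by simp)

/-- Along a sequence with at most `k` switches, the costs of the heuristics exceed the cost of the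
combined path by at most `k` times the diameter. -/
lemma Instance.sum_cost_le_pathCost [BoundedSpace M] (P : Instance M ℓ) (i : ℕ → Fin ℓ) {k : ℕ}
    (hk : ((Finset.Icc 2 P.T).filter fun t => i (t - 1) ≠ i t).card ≤ k) :
    ∑ t ∈ Finset.Icc 1 P.T, P.f (i t) t ≤
      P.pathCost (fun t => P.state (i t) t) + k * ENNReal.ofReal (diameter M) := by
  have h1 : ∀ t ∈ Finset.Icc 1 P.T, P.f (i t) t ≤
      (P.c t (P.state (i t) t) + edist (P.state (i (t - 1)) (t - 1)) (P.state (i t) t)) +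
        if 2 ≤ t ∧ i (t - 1) ≠ i t then ENNReal.ofReal (diameter M) else 0 := by
    intro t ht
    rw [Finset.mem_Icc] at ht
    unfold Instance.f
    by_cases h : i (t - 1) = i t
    · rw [h]; exact le_self_add
    · by_cases h2 : 2 ≤ t
      · rw [if_pos ⟨h2, h⟩, add_assoc]
        gcongr
        refine le_add_left ?_
        rw [edist_dist]
        exact ENNReal.ofReal_le_ofReal
          (Metric.dist_le_diam_of_mem (Bornology.IsBounded.all _) trivial trivial)
      · obtain rfl : t = 1 := by omega
        rw [Nat.sub_self, P.state_zero, P.state_zero]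
        exact le_self_add
  refine (Finset.sum_le_sum h1).trans ?_
  rw [Finset.sum_add_distrib, ← Finset.sum_filter, Finset.sum_const, nsmul_eq_mul]
  refine add_le_add le_rfl ?_
  gcongr
  refine (Finset.card_le_card fun t ht => ?_).trans hk
  simp only [Finset.mem_filter, Finset.mem_Icc] at ht ⊢
  exact ⟨⟨ht.2.1, ht.1.2⟩, ht.2.2⟩

end Benchmark

/-! ### The choice of the parameters -/

/-- The parameters in terms of `γ = √α`. -/
lemma params_spec {D ℓ k m V : ℝ} (hD : 0 < D) (hℓ : 0 < ℓ) (hk : 0 < k) (hm : 0 < m)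
    (hV : 0 < V) :
    ∃ γ : ℝ, 0 < γ ∧ paramα D ℓ k m V = γ ^ 2 ∧ m ^ 2 * paramε D ℓ k m V = γ ∧
      D * ℓ * k = γ ^ 2 * paramε D ℓ k m V * V ∧ paramη D ℓ k m V = Real.log (1 / (1 - γ)) ∧
      (D * ℓ * k) ^ (1 / 3 : ℝ) * m ^ (2 / 3 : ℝ) * V ^ (2 / 3 : ℝ) = γ * V ∧
      ℓ ^ (1 / 3 : ℝ) * V ^ (2 / 3 : ℝ) / ((D * k) ^ (2 / 3 : ℝ) * m ^ (4 / 3 : ℝ)) =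
        ℓ / γ ^ 2 := by
  -- In terms of cube roots all fractional powers become integral ones, and γ is the cube root of
  -- Dℓkm²/V.
  have cube : ∀ {a : ℝ}, 0 < a → ∃ p : ℝ, 0 < p ∧ a = p ^ 3 := fun {a} ha =>
    ⟨a ^ (1 / 3 : ℝ), by positivity, by
      rw [← Real.rpow_natCast, ← Real.rpow_mul ha.le]; norm_num⟩
  have root : ∀ {p : ℝ} (n : ℕ), 0 < p → (p ^ 3) ^ ((n : ℝ) / 3) = p ^ n := fun {p} n hp => by
    rw [← Real.rpow_natCast p 3, ← Real.rpow_mul hp.le, ← Real.rpow_natCast p n]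
    congr 1; push_cast; ring
  obtain ⟨d, hd, hd3⟩ := cube (mul_pos hD hk)
  obtain ⟨lam, hlam, hl3⟩ := cube hℓ
  obtain ⟨μ, hμ, hm3⟩ := cube hm
  obtain ⟨v, hv, hv3⟩ := cube hV
  have hprod : D * ℓ * k = (d * lam) ^ 3 := by
    rw [mul_pow, ← hd3, ← hl3]; ring
  have r1 : ∀ {p : ℝ}, 0 < p → (p ^ 3) ^ (1 / 3 : ℝ) = p := fun hp => by
    simpa using root 1 hp
  have r2 : ∀ {p : ℝ}, 0 < p → (p ^ 3) ^ (2 / 3 : ℝ) = p ^ 2 := fun hp => by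
    simpa using root 2 hp
  have r4 : ∀ {p : ℝ}, 0 < p → (p ^ 3) ^ (4 / 3 : ℝ) = p ^ 4 := fun hp => by
    simpa using root 4 hp
  have hdl : 0 < d * lam := by positivity
  have hε : paramε D ℓ k m V = d * lam / (v * μ ^ 4) := by
    unfold paramε
    rw [hprod, hv3, hm3, Real.rpow_neg (by positivity), Real.rpow_neg (by positivity),
      r1 hv, r1 hdl, r4 hμ]
    field_simp
  have hα : D * ℓ * k / (paramε D ℓ k m V * V) = (d * lam * μ ^ 2 / v) ^ 2 := by
    rw [hε, hprod, hv3]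
    field_simp
  have hγ : 0 < d * lam * μ ^ 2 / v := by positivity
  refine ⟨d * lam * μ ^ 2 / v, hγ, hα, ?_, ?_, ?_, ?_, ?_⟩
  · rw [hε, hm3]; field_simp
  · rw [← hα]
    have : 0 < paramε D ℓ k m V := by rw [hε]; positivity
    field_simp
  · rw [paramη, hα, Real.sqrt_sq hγ.le]
  · rw [hprod, hm3, hv3, r1 hdl, r2 hμ, r2 hv]; field_simp
  · rw [hd3, hm3, hv3, hl3, r1 hlam, r2 hd, r2 hv, r4 hμ]; field_simp

end MTS

/-! ### The main theorem -/

theorem theorem2 :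
    ∃ C : ℝ, 0 < C ∧
      ∀ (M : Type*) [MetricSpace M] [BoundedSpace M]
        (ℓ : ℕ) [NeZero ℓ] (m k : ℕ) (_ : 2 ≤ m) (_ : 1 ≤ k)
        (P : MTS.Instance M ℓ) (D V : ℝ)
        (_ : D = MTS.diameter M)
        (_ : V = (P.optLE k).toReal)
        -- the cost of each heuristic in each step is in `[0, 2D]`
        (_ : ∀ i, ∀ t ∈ Finset.Icc 1 P.T, P.f i t ≤ ENNReal.ofReal (2 * D))
        -- the offline optimum is at least `2k`
        (_ : 2 * (k : ENNReal) ≤ P.offlineOpt)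
        -- the parameters are admissible for SHARE
        (_ : MTS.paramα D ℓ k m V ≤ 1 / 2)
        (τ : (Fin ℓ → ℝ) → (Fin ℓ → ℝ) → Fin ℓ → Fin ℓ → ℝ) (_ : MTS.IsOptimalPlan τ)
        (greedy : ℕ → M → M) (_ : P.IsGreedy greedy),
        P.expectedCost m (MTS.paramε D ℓ k m V) (MTS.paramη D ℓ k m V) (MTS.paramα D ℓ k m V)
            τ greedy
          ≤ P.optLE k + ENNReal.ofReal
              (C * ((D * ℓ * k) ^ (1 / 3 : ℝ) * (m : ℝ) ^ (2 / 3 : ℝ) * V ^ (2 / 3 : ℝ)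
                * Real.log ((ℓ : ℝ) ^ (1 / 3 : ℝ) * V ^ (2 / 3 : ℝ)
                    / ((D * k) ^ (2 / 3 : ℝ) * (m : ℝ) ^ (4 / 3 : ℝ))))) := by
  refine ⟨100000, by norm_num, ?_⟩
  intro M _ _ ℓ _ m k hm hk P D V hDdef hVdef hcost hopt hα τ hτ greedy hg
  have hm' : (2 : ℝ) ≤ m := by exact_mod_cast hm
  have hk' : (1 : ℝ) ≤ k := by exact_mod_cast hk
  have hℓ' : (1 : ℝ) ≤ ℓ := Nat.one_le_cast.2 (Nat.pos_of_ne_zero (NeZero.ne ℓ))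
  -- the benchmark is positive and finite
  have hsum := P.optLE_le_sum k 0
  have hpos : 0 < P.optLE k :=
    lt_of_lt_of_le (by simp; omega) (hopt.trans (P.offlineOpt_le_optLE k))
  have htop : P.optLE k ≠ ⊤ := by
    refine ne_top_of_le_ne_top (ENNReal.sum_ne_top.2 fun t ht => ?_) hsum
    exact ne_top_of_le_ne_top ENNReal.ofReal_ne_top (hcost 0 t ht)
  have hV : 0 < V := hVdef ▸ ENNReal.toReal_pos hpos.ne' htop
  have hVof : P.optLE k = ENNReal.ofReal V := by rw [hVdef, ENNReal.ofReal_toReal htop]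
  -- For D = 0 all costs of the heuristics would vanish, contradicting the positive benchmark.
  have hD : 0 < D := by
    by_contra hD
    refine hpos.ne' (le_antisymm (hsum.trans ?_) bot_le)
    refine (Finset.sum_le_sum fun t ht => (hcost 0 t ht).trans_eq
      (ENNReal.ofReal_of_nonpos (by linarith))).trans_eq (by simp)
  -- the parameters
  obtain ⟨γ, hγ0, hαγ, hεγ, hDk, hη, hregret, hlogarg⟩ :=
    MTS.params_spec hD (by linarith : (0 : ℝ) < ℓ) (by linarith : (0 : ℝ) < k)
      (by linarith : (0 : ℝ) < m) hV
  rw [hregret, hlogarg]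
  set ε := MTS.paramε D ℓ k m V
  set η := MTS.paramη D ℓ k m V
  set α := MTS.paramα D ℓ k m V
  have hγ1 : γ ≤ 3 / 4 := by
    rw [hαγ] at hα; nlinarith
  have hα0 : 0 < α := by rw [hαγ]; positivity
  have hε0 : 0 < ε := by
    by_contra h
    have := mul_nonpos_of_nonneg_of_nonpos (sq_nonneg (m : ℝ)) (not_lt.1 h)
    linarith
  have h1γ : 0 < 1 - γ := by linarith
  have hη0 : 0 ≤ η := by
    rw [hη]; exact Real.log_nonneg ((one_le_div h1γ).2 (by linarith))
  have hexp : γ = 1 - Real.exp (-η) := by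
    rw [hη, one_div, Real.log_inv, neg_neg, Real.exp_log h1γ]; ring
  have hη1 : η * (1 - γ) ≤ γ := by
    have := Real.add_one_le_exp η
    have h2 : Real.exp η * (1 - γ) = 1 := by
      rw [hη, Real.exp_log (by positivity)]; field_simp
    nlinarith
  have hmε : 2 * (m * ε) ≤ γ := by
    have h1 : m * (m * ε) = γ := by rw [← hεγ]; ring
    have h2 := mul_le_mul_of_nonneg_right hm' (by positivity : 0 ≤ m * ε)
    linarith
  have hadm : P.Admissible m ε η α γ D :=
    { two_le := hm
      diam_eq := hDdef
      diam_pos := hD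
      cost_le := hcost
      η_nonneg := hη0
      α_pos := hα0
      α_le := hα
      γ_eq := hexp
      γ_le := hγ1
      ε_pos := hε0
      ε_le := by
        have := mul_le_mul_of_nonneg_right hm' hε0.le
        linarith
      mε_le := by linarith }
  -- a nearly optimal combination of the heuristics
  obtain ⟨i, hi, hicost⟩ : ∃ i : ℕ → Fin ℓ,
      ((Finset.Icc 2 P.T).filter fun t => i (t - 1) ≠ i t).card ≤ k ∧
      P.pathCost (fun t => P.state (i t) t) < ENNReal.ofReal ((1 + γ) * V) := by
    -- A slack of γV is affordable, so an approximate minimizer suffices. The other γV in `hF` pays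
    -- for the at most k switches: `Instance.f` charges a heuristic's own movement, which differs
    -- from that of the combined path by at most D per switch.
    have hlt : P.optLE k < ENNReal.ofReal ((1 + γ) * V) := by
      rw [hVof]
      exact (ENNReal.ofReal_lt_ofReal_iff (by positivity)).2 (by nlinarith)
    rw [MTS.Instance.optLE] at hlt
    simpa only [iInf_lt_iff, exists_prop] using hlt
  have hF : ∑ t ∈ Finset.Icc 1 P.T, (P.f (i t) t).toReal ≤ (1 + 2 * γ) * V := by
    rw [← ENNReal.toReal_sum fun t ht => hadm.cost_ne_top ht _]
    have hkD : D * k ≤ γ * V := by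
      have h1 : D * k * 1 ≤ D * k * ℓ := by gcongr
      have h2 : D * k * ℓ = α * ε * V := by rw [hαγ, ← hDk]; ring
      have h3 : α * ε ≤ γ := by
        have h4 := mul_le_mul_of_nonneg_right hα hε0.le
        have h5 := mul_le_mul_of_nonneg_right hm' hε0.le
        linarith
      have h4 := mul_le_mul_of_nonneg_right h3 hV.le
      linarith
    refine ENNReal.toReal_le_of_le_ofReal (by positivity)
      ((P.sum_cost_le_pathCost i hi).trans ((add_le_add hicost.le le_rfl).trans ?_))
    rw [← hDdef, ← ENNReal.ofReal_natCast, ← ENNReal.ofReal_mul (by positivity),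
      ← ENNReal.ofReal_add (by positivity) (by positivity)]
    exact ENNReal.ofReal_le_ofReal (by linarith)
  -- the logarithm is bounded from below
  have hlog : Real.log 2 ≤ Real.log (ℓ / γ ^ 2) := by
    refine Real.log_le_log two_pos ?_
    rw [← hαγ, le_div_iff₀ hα0]
    linarith
  have hlog2 : Real.log (2 * ℓ / α) ≤ 2 * Real.log (ℓ / γ ^ 2) := by
    rw [mul_div_assoc, hαγ, Real.log_mul two_ne_zero (by positivity)]
    linarith
  have hlog1 : 1 / 2 ≤ Real.log (ℓ / γ ^ 2) := by
    linarith [Real.log_two_gt_d9]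
  obtain ⟨A, hA, hAΛ, B, hB, htotal⟩ := hadm.total_le
  have hΛ : 0 ≤ ∑ t ∈ Finset.Icc 1 P.T, P.expLoss m ε η α t :=
    Finset.sum_nonneg fun t _ => hadm.expLoss_nonneg t
  rw [← hαγ] at hDk
  have hA1 := MTS.observable_le_benchmark hℓ' hk' hD hV hγ0 hγ1 hαγ hα hε0 hη0 hη1 hDk hAΛ
    (hadm.sum_expLoss_le i hi) hF hlog1 hlog2
  have hS1 := MTS.total_le_observable hm' hℓ' hk' hD hV hγ0 hγ1 hα0 hα hεγ hε0 hη0 hη1 hDk hA hΛ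
    hAΛ hB htotal
  refine (hadm.expectedCost_le hτ hg).trans ?_
  rw [hVof, ← ENNReal.ofReal_add hV.le (by positivity)]
  exact ENNReal.ofReal_le_ofReal (MTS.final_arithmetic hV hγ0 hγ1 hlog1 hA1 hS1)
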